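/- Let $\pi:S^5\to\mathbb{C}P^2=S^5/S^1$ be the Hopf map, let $\mathbb{C}P^2$ carry the Fubini--Study Hermitian metric $\langle\cdot,\cdot\rangle-i\omega$ for which $d\pi_z:z^{\perp}\to T_{\pi(z)}\mathbb{C}P^2$ is a Hermitian isometry for every $z\in S^5$, and let $J$ be its complex structure. Let $S^1=\mathbb{R}/2\pi\mathbb{Z}$. A *homogeneous Hamiltonian stationary Lagrangian torus* is a smooth Lagrangian immersion $u:S^1\times S^1\to\mathbb{C}P^2$ (so $u^*\omega=0$) such that - $u$ is Hamiltonian stationary: $\int_{S^1\times S^1}\langle\vec H,J\nabla h\rangle\,d\mathrm{vol}=0$ for every $h\in C^\infty(\mathbb{C}P^2,\mathbb{R})$, where $\vec H$ is the mean curvature vector and $d\mathrm{vol}$ the area element of the induced metric; - $u$ is homogeneous: there are skew-Hermitian $3\times 3$ matrices $A,B$ with $u(x+t,y)=e^{tA}u(x,y)$ and $u(x,y+t)=e^{tB}u(x,y)$ for all $x,y\in S^1$, $t\in\mathbb{R}$. It is *minimal* if $\vec H=0$, and *special Lagrangian* if its Lagrangian angle $\beta$ is constant, i.e. if for every Legendrian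 (horizontal) local lift $\hat u$ of $u$ to $S^5$ over a connected open subset $W$ of the universal cover $\mathbb{R}^2$ the function $e^{i\beta}=dz^1\wedge dz^2\wedge dz^3\,(\hat u,d\hat u(e_1),d\hat u(e_2))$, where $(e_1,e_2)$ is an oriented orthonormal frame for the induced metric, is constant on $W$. For $r_1,r_2,r_3>0$ with $r_1^2+r_2^2+r_3^2=1$ let $$T_r=r_1S^1\times r_2S^1\times r_3S^1=\{z\in\mathbb{C}^3:\ |z^1|=r_1,\ |z^2|=r_2,\ |z^3|=r_3\}\subset S^5.$$ **Theorem.** 1. For every homogeneous Hamiltonian stationary Lagrangian torus $u$ there are $g\in U(3)$ and $r_1,r_2,r_3>0$ with $r_1^2+r_2^2+r_3^2=1$ such that the image of $u$ is $g\cdot\pi(T_r)$. 2. If $u$ is a homogeneous Hamiltonian stationary Lagrangian torus with image $g\cdot\pi(T_r)$, for some $g\in U(3)$ and such $r$, then $u$ is special Lagrangian if and only if $r_1=r_2=r_3=1/\sqrt3$ (that is, the image is congruent to the Clifford torus $\pi(\{|z^1|=|z^2|=|z^3|=1/\sqrt3\})$), and likewise $u$ is minimal if and only if $r_1=r_2=r_3=1/\sqrt3$.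 3. Conversely, for all $r_1,r_2,r_3>0$ with $r_1^2+r_2^2+r_3^2=1$, $\pi(T_r)$ is the image of an injective homogeneous Hamiltonian stationary Lagrangian torus $u$. -/

import Mathlib

open scoped ContDiff Real Topology LinearAlgebra.Projectivization

namespace HSLTorus

noncomputable section

/-! ### The complex projective plane and the Hopf map -/

/-- `ℂ³` with its standard Hermitian inner product. As in Mathlib, `inner ℂ` is conjugate-linear
in the first variable. -/
abbrev C3 : Type := EuclideanSpace ℂ (Fin 3)

/-- The complex projective plane, as the set of complex lines of `ℂ³`. -/
abbrev CP2 : Type := ℙ ℂ C3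

/-- The unit sphere `S⁵` in `ℂ³`. -/
abbrev S5 : Set C3 := Metric.sphere (0 : C3) 1

/-- The Hopf map `π : S⁵ → ℂP²`, `z ↦ [z]`. -/
def hopf (z : S5) : CP2 := Projectivization.mk ℂ (z : C3) (ne_zero_of_mem_unit_sphere z)

theorem toEuclideanLin_injective {M : Matrix (Fin 3) (Fin 3) ℂ} (hM : IsUnit M) :
    Function.Injective (Matrix.toEuclideanLin M) := by
  intro v w h
  have h2 : M.mulVec v.ofLp = M.mulVec w.ofLp := congrArg WithLp.ofLp h
  exact WithLp.ofLp_injective 2 (Matrix.mulVec_injective_of_isUnit hM h2)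

/-- The projective transformation `[z] ↦ [M z]` of `ℂP²` induced by an invertible matrix `M`. -/
def projAct (M : Matrix (Fin 3) (Fin 3) ℂ) (hM : IsUnit M) : CP2 → CP2 :=
  Projectivization.map (Matrix.toEuclideanLin M) (toEuclideanLin_injective hM)

/-- The action of `U(3)` on `ℂP²`. -/
def unitaryAct (g : Matrix.unitaryGroup (Fin 3) ℂ) : CP2 → CP2 :=
  projAct (g : Matrix (Fin 3) (Fin 3) ℂ) (Unitary.isUnit_coe (U := g))

/-- The action of `e^{tA}` on `ℂP²`. -/
def expAct (A : Matrix (Fin 3) (Fin 3) ℂ) (t : ℝ) : CP2 → CP2 :=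
  projAct (NormedSpace.exp ((t : ℂ) • A)) (Matrix.isUnit_exp _)

/-- The product torus `r₁S¹ × r₂S¹ × r₃S¹ = {z | |z_i| = r_i}`, for `∑ r_i² = 1` a subset of the
unit sphere. -/
def productTorus (r : Fin 3 → ℝ) : Set S5 := {z | ∀ i, ‖(z : C3) i‖ = r i}

/-! ### Smooth maps into `ℂP²`

The differential geometry of `ℂP² = S⁵/S¹` is expressed through lifts to `S⁵`: the tangent space of
`ℂP²` at `[z]`, `z ∈ S⁵`, is the space `H_z` of vectors Hermitian orthogonal to `z`, and the
Fubini-Study metric is the one for which `dπ_z : H_z → T_{[z]} ℂP²` is a complex isometry. None of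
the geometric notions below depends on the choice of the lifts. -/

/-- `f` is a smooth lift to `S⁵`, over the open set `W`, of the map `U : ℝ² → ℂP²`. -/
structure IsLift (U : ℝ × ℝ → CP2) (W : Set (ℝ × ℝ)) (f : ℝ × ℝ → C3) : Prop where
  isOpen : IsOpen W
  smooth : ContDiffOn ℝ ∞ f W
  lifts : ∀ p ∈ W, ∃ h : f p ∈ S5, hopf ⟨f p, h⟩ = U p

/-- A map from the plane to `ℂP²` is smooth if it has smooth lifts to `S⁵` near every point. -/
def SmoothMap (U : ℝ × ℝ → CP2) : Prop :=
  ∀ p, ∃ W f, p ∈ W ∧ IsLift U W f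

/-- A function on `ℂP²` read on `ℂ³ ∖ {0}` (and extended by `0` to the origin). -/
def onC3 (h : CP2 → ℝ) (z : C3) : ℝ :=
  open Classical in if hz : z ≠ 0 then h (Projectivization.mk ℂ z hz) else 0

/-- Smoothness of a real function on `ℂP²`. -/
def SmoothFun (h : CP2 → ℝ) : Prop := ContDiffOn ℝ ∞ (onC3 h) {0}ᶜ

/-- The orthogonal projection of `ℂ³` on the horizontal space `H_z`, for `z ∈ S⁵`. -/
def hor (z v : C3) : C3 := v - (inner ℂ z v : ℂ) • z

/-- The Kähler form `ω(X, Y) = -Im ⟨X, Y⟩`, where `⟨X, Y⟩ = g(X, Y) - i ω(X, Y)` is the Hermitian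
metric that is complex linear in `X`. -/
def kahler (X Y : C3) : ℝ := - (inner ℂ Y X : ℂ).im

/-- The horizontal lift, along the lift `f` of `U`, of `dU_p(v)`. -/
def dHor (f : ℝ × ℝ → C3) (p v : ℝ × ℝ) : C3 := hor (f p) (fderiv ℝ f p v)

/-- The map `U` has an injective differential everywhere. -/
def IsImmersion (U : ℝ × ℝ → CP2) : Prop :=
  SmoothMap U ∧ ∀ W f, IsLift U W f → ∀ p ∈ W, Function.Injective (dHor f p)

/-- The immersion `U` of a surface is Lagrangian: `U^* ω = 0`. -/
def IsLagrangianImmersion (U : ℝ × ℝ → CP2) : Prop :=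
  IsImmersion U ∧ ∀ W f, IsLift U W f → ∀ p ∈ W, ∀ v w, kahler (dHor f p v) (dHor f p w) = 0

/-! ### Induced metric, mean curvature, Hamiltonian stationarity -/

/-- The coordinate vectors of the plane. -/
def coordVec : Fin 2 → ℝ × ℝ := ![(1, 0), (0, 1)]

/-- The matrix `(g_ij)` of the metric induced by the Fubini-Study metric. -/
def gram (f : ℝ × ℝ → C3) (p : ℝ × ℝ) : Matrix (Fin 2) (Fin 2) ℝ :=
  Matrix.of fun i j => inner ℝ (dHor f p (coordVec i)) (dHor f p (coordVec j))

/-- The density of the induced area. -/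
def areaDensity (f : ℝ × ℝ → C3) (p : ℝ × ℝ) : ℝ := √(gram f p).det

/-- The covariant derivative, for the Levi-Civita connection of the Fubini-Study metric, of a
vector field along `U` in the direction `v`: the field is given by its horizontal lift `V` along
`f`, so that the derivative is `V' = dV(v)`, corrected for the vertical part
`⟨f, df(v)⟩ f` of `df(v)` and projected on the horizontal space. -/
def covDeriv (f V : ℝ × ℝ → C3) (p v : ℝ × ℝ) : C3 :=
  hor (f p) (fderiv ℝ V p v - (inner ℂ (f p) (fderiv ℝ f p v) : ℂ) • V p)

/-- The component of a horizontal vector `X` normal to the immersed surface: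
`X - ∑ g^{kl} ⟨X, ∂_k U⟩ ∂_l U`. -/
def normalPart (f : ℝ × ℝ → C3) (p : ℝ × ℝ) (X : C3) : C3 :=
  X - ∑ k, ∑ l, ((gram f p)⁻¹ k l * inner ℝ X (dHor f p (coordVec k))) • dHor f p (coordVec l)

/-- The second fundamental form `II(∂_i, ∂_j)`. -/
def secondFF (f : ℝ × ℝ → C3) (p : ℝ × ℝ) (i j : Fin 2) : C3 :=
  normalPart f p (covDeriv f (fun q => dHor f q (coordVec j)) p (coordVec i))

/-- (The horizontal lift of) the mean curvature vector, half the trace of the second fundamental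
form with respect to the induced metric. -/
def meanCurvature (f : ℝ × ℝ → C3) (p : ℝ × ℝ) : C3 :=
  (1 / 2 : ℝ) • ∑ i, ∑ j, (gram f p)⁻¹ i j • secondFF f p i j

/-- (The horizontal lift at `z ∈ S⁵` of) the Hamiltonian vector field `ξ_h = J ∇h` on `ℂP²`. The
gradient of the homogeneous extension of `h` at `z` is horizontal, as `h` is constant on complex
lines. -/
def hamiltonianField (h : CP2 → ℝ) (z : C3) : C3 := Complex.I • gradient (onC3 h) z

/-- Some lift of `U` defined near `p`. -/
def someLift (U : ℝ × ℝ → CP2) (p : ℝ × ℝ) : ℝ × ℝ → C3 :=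
  Classical.epsilon fun f => ∃ W, p ∈ W ∧ IsLift U W f

/-- The function `⟨H, ξ_h⟩ dvol / (dx dy)` on the plane; it is independent of the lift which is used
to compute it. -/
def variationDensity (U : ℝ × ℝ → CP2) (h : CP2 → ℝ) (p : ℝ × ℝ) : ℝ :=
  inner ℝ (meanCurvature (someLift U p) p) (hamiltonianField h (someLift U p p)) *
    areaDensity (someLift U p) p

/-- The torus `S¹ × S¹`, with `S¹ = ℝ/2πℤ`. -/
abbrev Torus : Type := AddCircle (2 * π) × AddCircle (2 * π)

/-- A map on the torus as a doubly periodic map on the plane. -/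
def onPlane (u : Torus → CP2) (p : ℝ × ℝ) : CP2 :=
  u ((p.1 : AddCircle (2 * π)), (p.2 : AddCircle (2 * π)))

/-- The first variation `∫ ⟨H, ξ_h⟩ dvol` of the area of the immersed torus `u` under every
Hamiltonian vector field `ξ_h` vanishes. -/
def IsHamiltonianStationary (u : Torus → CP2) : Prop :=
  ∀ h : CP2 → ℝ, SmoothFun h →
    ∫ x in (0 : ℝ)..2 * π, ∫ y in (0 : ℝ)..2 * π, variationDensity (onPlane u) h (x, y) = 0

/-- `u(x + t, y) = e^{tA} u(x, y)` and `u(x, y + t) = e^{tB} u(x, y)` for some skew-Hermitian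
matrices `A` and `B`. -/
def IsHomogeneous (u : Torus → CP2) : Prop :=
  ∃ A B : Matrix (Fin 3) (Fin 3) ℂ, A.conjTranspose = -A ∧ B.conjTranspose = -B ∧
    (∀ (x y : AddCircle (2 * π)) (t : ℝ),
      u (x + (t : AddCircle (2 * π)), y) = expAct A t (u (x, y))) ∧
    (∀ (x y : AddCircle (2 * π)) (t : ℝ),
      u (x, y + (t : AddCircle (2 * π))) = expAct B t (u (x, y)))

/-- Homogeneous Hamiltonian stationary Lagrangian (immersed) tori in `ℂP²`. -/
structure IsHomogeneousHSLTorus (u : Torus → CP2) : Prop where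
  lagrangian : IsLagrangianImmersion (onPlane u)
  stationary : IsHamiltonianStationary u
  homogeneous : IsHomogeneous u

/-! ### Minimal and special Lagrangian tori -/

/-- The mean curvature vector vanishes. -/
def IsMinimal (u : Torus → CP2) : Prop :=
  ∀ W f, IsLift (onPlane u) W f → ∀ p ∈ W, meanCurvature f p = 0

/-- The lift `f` is parallel for the Hopf connection, that is, horizontal. -/
def IsLegendrian (W : Set (ℝ × ℝ)) (f : ℝ × ℝ → C3) : Prop :=
  ∀ p ∈ W, ∀ v, (inner ℂ (f p) (fderiv ℝ f p v) : ℂ) = 0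

/-- `e^{iβ}`, where `β` is the Lagrangian angle of the Legendrian lift `f`:
`e^{iβ} = dz¹ ∧ dz² ∧ dz³ (f, df(e₁), df(e₂))` for an oriented orthonormal frame `(e₁, e₂)` of the
plane with the induced metric, so that `e₁ ∧ e₂ = (∂_x ∧ ∂_y) / √det g`. -/
def expLagrangianAngle (f : ℝ × ℝ → C3) (p : ℝ × ℝ) : ℂ :=
  (Matrix.of fun a b : Fin 3 =>
    (![f p, fderiv ℝ f p (coordVec 0), fderiv ℝ f p (coordVec 1)] a : C3) b).det /
      (areaDensity f p : ℂ)

/-- The Lagrangian angle, computed along Legendrian lifts over connected open sets, is constant. -/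
def IsSpecialLagrangian (u : Torus → CP2) : Prop :=
  ∀ W f, IsLift (onPlane u) W f → IsLegendrian W f → IsPreconnected W →
    ∃ c : ℂ, ∀ p ∈ W, expLagrangianAngle f p = c

end

end HSLTorus

/-! A homogeneous torus is an orbit of the flows of two skew-Hermitian maps `S`, `T`. At a point `w`
of a lift, the Lagrangian condition makes `w`, `S w`, `T w` a complex basis of `ℂ³`. The flows
commute on the points of the orbit, so `C = S * T - T * S` preserves every line of the orbit.
Differentiating this along the flows and using that `C` is skew gives `C = ν` on the basis, and the
trace forces `ν = 0` (`commute_of_lagrangian`). A joint orthonormal eigenbasis diagonalizes both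
flows; no coordinate of `w` vanishes, again because of the basis property. After moving phases into
the basis and removing a common phase, the torus has the global horizontal lift `p ↦ ∑ r_j e^{i
α_j(p)} b_j`, where the linear forms `α_j` satisfy `∑ r_j² α_j = 0` and have no common zero but `0`
(`exists_toricLift`).

For such a lift all the geometry is algebra of coefficient vectors. By dimension, `v ↦ (α_j v)` is
onto the plane `∑ r_j² θ_j = 0` (`exists_velocity`). Hence the image is the whole product torus in
the basis `b`, and the mean curvature has coefficients `(3 - 1 / r_k²) / 2`, which vanish exactly
when `r_k² = 1/3`. Multiplied by `i` it is the tangent vector of a constant field on the plane, so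
the first variation is the integral of a constant-coefficient derivative of a periodic function and
vanishes. The Lagrangian angle is, up to a constant, `∑ α_j`, which is zero exactly when all radii
agree.

Part 2 refers to any description `g · π(T_r)` of the image, so the radii must be recovered from the
image alone: a linear form of constant modulus on a product torus involves a single coordinate
(`exists_eq_mul_norm`). -/

namespace HSLTorus

noncomputable section

/-- The Hermitian product of `ℂ³` coming from its structure of inner product space. Declared here
so that it takes precedence over the (definitionally equal) one of Hilbert `C⋆`-modules. -/
instance instInnerC3 : Inner ℂ C3 := InnerProductSpace.toInner

theorem hor_eq (z v : C3) : hor z v = v - (inner ℂ z v : ℂ) • z := rfl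

theorem kahler_eq (X Y : C3) : kahler X Y = -(inner ℂ Y X : ℂ).im := rfl

theorem covDeriv_eq (f V : ℝ × ℝ → C3) (p v : ℝ × ℝ) :
    covDeriv f V p v =
      hor (f p) (fderiv ℝ V p v - (inner ℂ (f p) (fderiv ℝ f p v) : ℂ) • V p) := rfl

theorem real_inner_eq (x y : C3) : inner ℝ x y = (inner ℂ x y : ℂ).re := rfl

theorem conj_mul_self_of_norm_one {c : ℂ} (hc : ‖c‖ = 1) : (starRingEnd ℂ) c * c = 1 := by
  rw [mul_comm, Complex.mul_conj, Complex.normSq_eq_norm_sq, hc]; norm_num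

theorem inner_self_of_norm_one {z : C3} (hz : ‖z‖ = 1) : (inner ℂ z z : ℂ) = 1 := by
  have := inner_self_eq_norm_sq_to_K (𝕜 := ℂ) z
  rw [hz] at this
  simpa using this

/-! ### Algebra of the horizontal projection -/

theorem hor_add (z v w : C3) : hor z (v + w) = hor z v + hor z w := by
  simp only [hor_eq, inner_add_right, add_smul]; abel

theorem hor_smul (z v : C3) (c : ℂ) : hor z (c • v) = c • hor z v := by
  simp only [hor_eq, inner_smul_right, smul_sub, smul_smul]

theorem hor_self {z : C3} (hz : ‖z‖ = 1) : hor z z = 0 := by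
  rw [hor_eq, inner_self_of_norm_one hz, one_smul, sub_self]

theorem hor_smul_left {c : ℂ} (hc : ‖c‖ = 1) (z v : C3) : hor (c • z) v = hor z v := by
  have h := conj_mul_self_of_norm_one hc
  rw [hor_eq, hor_eq, inner_smul_left, smul_smul]
  congr 2
  linear_combination (inner ℂ z v : ℂ) * h

theorem inner_hor {z : C3} (hz : ‖z‖ = 1) (v : C3) : (inner ℂ z (hor z v) : ℂ) = 0 := by
  rw [hor_eq, inner_sub_right, inner_smul_right, inner_self_of_norm_one hz, mul_one, sub_self]

theorem inner_smul_smul {c : ℂ} (hc : ‖c‖ = 1) (x y : C3) :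
    (inner ℂ (c • x) (c • y) : ℂ) = inner ℂ x y := by
  have h := conj_mul_self_of_norm_one hc
  rw [inner_smul_left, inner_smul_right]
  linear_combination (inner ℂ x y : ℂ) * h

theorem real_inner_smul_smul {c : ℂ} (hc : ‖c‖ = 1) (x y : C3) :
    inner ℝ (c • x) (c • y) = inner ℝ x y := by
  rw [real_inner_eq, real_inner_eq, inner_smul_smul hc]

/-! ### Change of lift -/

/-- Over the open set `W`, the map `f` is `c • g`, with `g` of values in the sphere and `c` of
values in the unit circle. -/
structure IsGauge (W : Set (ℝ × ℝ)) (c : ℝ × ℝ → ℂ) (f g : ℝ × ℝ → C3) : Prop where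
  isOpen : IsOpen W
  smooth_fun : ContDiffOn ℝ ∞ c W
  smooth : ContDiffOn ℝ ∞ g W
  eq : ∀ p ∈ W, f p = c p • g p
  norm_fun : ∀ p ∈ W, ‖c p‖ = 1
  norm : ∀ p ∈ W, ‖g p‖ = 1

theorem IsLift.norm {U : ℝ × ℝ → CP2} {W : Set (ℝ × ℝ)} {f : ℝ × ℝ → C3} (hf : IsLift U W f)
    {p : ℝ × ℝ} (hp : p ∈ W) : ‖f p‖ = 1 := by
  obtain ⟨h, -⟩ := hf.lifts p hp
  simpa using h

theorem exists_smul_of_hopf_eq {z w : S5} (h : hopf z = hopf w) :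
    ∃ a : ℂ, ‖a‖ = 1 ∧ (z : C3) = a • (w : C3) := by
  obtain ⟨a, ha⟩ := (Projectivization.mk_eq_mk_iff' ℂ _ _ _ _).1 h
  refine ⟨a, ?_, ha.symm⟩
  have hz : ‖(z : C3)‖ = 1 := by simp
  have hw : ‖(w : C3)‖ = 1 := by simp
  rw [← ha, norm_smul, hw, mul_one] at hz
  exact hz

/-- Two unit vectors on the same line differ by a phase. Writing the phase as a Hermitian product of
the two lifts shows that it is smooth. -/
theorem IsLift.isGauge {U : ℝ × ℝ → CP2} {W W' : Set (ℝ × ℝ)} {f g : ℝ × ℝ → C3}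
    (hf : IsLift U W f) (hg : IsLift U W' g) :
    IsGauge (W ∩ W') (fun p => inner ℂ (g p) (f p)) f g := by
  have key : ∀ p ∈ W ∩ W', ‖(inner ℂ (g p) (f p) : ℂ)‖ = 1 ∧
      f p = (inner ℂ (g p) (f p) : ℂ) • g p := by
    rintro p ⟨hp, hp'⟩
    obtain ⟨h, h1⟩ := hf.lifts p hp
    obtain ⟨h', h2⟩ := hg.lifts p hp'
    obtain ⟨a, ha, hfa⟩ := exists_smul_of_hopf_eq (h1.trans h2.symm)
    simp only at hfa
    have : (inner ℂ (g p) (f p) : ℂ) = a := by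
      rw [hfa, inner_smul_right, inner_self_of_norm_one (hg.norm hp'), mul_one]
    rw [this]
    exact ⟨ha, hfa⟩
  refine ⟨hf.isOpen.inter hg.isOpen, ?_, hg.smooth.mono Set.inter_subset_right,
    fun p hp => (key p hp).2, fun p hp => (key p hp).1, fun p hp => hg.norm hp.2⟩
  exact ContDiffOn.inner ℂ (hg.smooth.mono Set.inter_subset_right)
    (hf.smooth.mono Set.inter_subset_left)

namespace IsGauge

variable {W : Set (ℝ × ℝ)} {c : ℝ × ℝ → ℂ} {f g : ℝ × ℝ → C3} {p : ℝ × ℝ}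

theorem differentiableAt_fun (h : IsGauge W c f g) (hp : p ∈ W) : DifferentiableAt ℝ c p :=
  (h.smooth_fun.contDiffAt (h.isOpen.mem_nhds hp)).differentiableAt (by simp)

theorem differentiableAt (h : IsGauge W c f g) (hp : p ∈ W) : DifferentiableAt ℝ g p :=
  (h.smooth.contDiffAt (h.isOpen.mem_nhds hp)).differentiableAt (by simp)

theorem fderiv_eq (h : IsGauge W c f g) (hp : p ∈ W) (v : ℝ × ℝ) :
    fderiv ℝ f p v = c p • fderiv ℝ g p v + fderiv ℝ c p v • g p := by
  have he : f =ᶠ[𝓝 p] fun q => c q • g q :=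
    Filter.eventuallyEq_of_mem (h.isOpen.mem_nhds hp) h.eq
  rw [he.fderiv_eq, fderiv_fun_smul (h.differentiableAt_fun hp) (h.differentiableAt hp)]
  simp

/-- Differentiating the phase only contributes a multiple of `g p`, which the horizontal projection
kills. -/
theorem dHor_eq (h : IsGauge W c f g) (hp : p ∈ W) (v : ℝ × ℝ) :
    dHor f p v = c p • dHor g p v := by
  rw [dHor, dHor, h.fderiv_eq hp, h.eq p hp, hor_smul_left (h.norm_fun p hp), hor_add, hor_smul,
    hor_smul, hor_self (h.norm p hp), smul_zero, add_zero]

theorem gram_eq (h : IsGauge W c f g) (hp : p ∈ W) : gram f p = gram g p := by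
  ext i j
  simp only [gram, Matrix.of_apply, h.dHor_eq hp]
  exact real_inner_smul_smul (h.norm_fun p hp) _ _

theorem areaDensity_eq (h : IsGauge W c f g) (hp : p ∈ W) : areaDensity f p = areaDensity g p := by
  rw [areaDensity, areaDensity, h.gram_eq hp]

theorem differentiableAt_dHor (h : IsGauge W c f g) (hp : p ∈ W) (w : ℝ × ℝ) :
    DifferentiableAt ℝ (fun q => dHor g q w) p := by
  have hg := h.smooth.contDiffAt (h.isOpen.mem_nhds hp)
  have h1 : ContDiffAt ℝ 1 (fun q => fderiv ℝ g q w) p :=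
    ((hg.fderiv_right (m := ∞) (by simp)).of_le (by simp)).clm_apply contDiffAt_const
  have h2 : ContDiffAt ℝ 1 g p := hg.of_le (by simp)
  have h3 : ContDiffAt ℝ 1 (fun q => hor (g q) (fderiv ℝ g q w)) p :=
    h1.sub ((ContDiffAt.inner ℂ h2 h1).smul h2)
  exact h3.differentiableAt (by simp)

/-- The derivative of `c` enters twice, through the product rule for the field and through the
vertical part of `df(v)`; the two contributions cancel because `|c| = 1`. -/
theorem covDeriv_dHor_eq (h : IsGauge W c f g) (hp : p ∈ W) (v w : ℝ × ℝ) :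
    covDeriv f (fun q => dHor f q w) p v = c p • covDeriv g (fun q => dHor g q w) p v := by
  have he : (fun q => dHor f q w) =ᶠ[𝓝 p] fun q => c q • dHor g q w :=
    Filter.eventuallyEq_of_mem (h.isOpen.mem_nhds hp) fun q hq => h.dHor_eq hq w
  have hc := conj_mul_self_of_norm_one (h.norm_fun p hp)
  rw [covDeriv_eq, covDeriv_eq, he.fderiv_eq,
    fderiv_fun_smul (h.differentiableAt_fun hp) (h.differentiableAt_dHor hp w), h.fderiv_eq hp,
    h.dHor_eq hp, h.eq p hp, hor_smul_left (h.norm_fun p hp), ← hor_smul]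
  congr 1
  simp only [add_apply, smul_apply,
    ContinuousLinearMap.smulRight_apply, inner_add_right, inner_smul_right, inner_smul_left,
    inner_self_of_norm_one (h.norm p hp), smul_sub, smul_smul, add_sub_assoc, ← sub_smul]
  rw [sub_eq_add_neg (c p • _), ← neg_smul]
  congr 2
  linear_combination (-(inner ℂ (g p) (fderiv ℝ g p v)) * c p - fderiv ℝ c p v) * hc

theorem normalPart_eq (h : IsGauge W c f g) (hp : p ∈ W) (X : C3) :
    normalPart f p (c p • X) = c p • normalPart g p X := by
  simp only [normalPart, h.gram_eq hp, h.dHor_eq hp, real_inner_smul_smul (h.norm_fun p hp),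
    smul_sub, Finset.smul_sum]
  congr 1
  refine Finset.sum_congr rfl fun k _ => Finset.sum_congr rfl fun l _ => ?_
  rw [smul_comm]

theorem secondFF_eq (h : IsGauge W c f g) (hp : p ∈ W) (i j : Fin 2) :
    secondFF f p i j = c p • secondFF g p i j := by
  rw [secondFF, secondFF, h.covDeriv_dHor_eq hp, h.normalPart_eq hp]

theorem meanCurvature_eq (h : IsGauge W c f g) (hp : p ∈ W) :
    meanCurvature f p = c p • meanCurvature g p := by
  simp only [meanCurvature, h.gram_eq hp, h.secondFF_eq hp, Finset.smul_sum]
  refine Finset.sum_congr rfl fun k _ => Finset.sum_congr rfl fun l _ => ?_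
  rw [smul_comm (c p), smul_comm (c p)]

end IsGauge

/-! ### The toric model -/

/-- The vector field with coordinates `θ_j r_j e^{i α_j}` in the orthonormal basis `b` along the
orbit of a point under a two-parameter group of diagonal unitary maps. -/
def toricField (b : OrthonormalBasis (Fin 3) ℂ C3) (r : Fin 3 → ℝ) (α : Fin 3 → ℝ × ℝ →L[ℝ] ℝ)
    (θ : Fin 3 → ℂ) (p : ℝ × ℝ) : C3 :=
  ∑ j, (θ j * (r j * Complex.exp (α j p * Complex.I))) • b j

/-- The orbit of `∑ r_j b_j` under a two-parameter group of diagonal unitary maps. -/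
def toricLift (b : OrthonormalBasis (Fin 3) ℂ C3) (r : Fin 3 → ℝ) (α : Fin 3 → ℝ × ℝ →L[ℝ] ℝ) :
    ℝ × ℝ → C3 :=
  toricField b r α 1

/-- The orbit `toricLift b r α` is an immersed horizontal surface of the sphere. -/
structure IsToricDatum (r : Fin 3 → ℝ) (α : Fin 3 → ℝ × ℝ →L[ℝ] ℝ) : Prop where
  pos : ∀ j, 0 < r j
  sum_sq : ∑ j, r j ^ 2 = 1
  balanced : ∀ v, ∑ j, r j ^ 2 * α j v = 0
  injective : ∀ v, (∀ j, α j v = 0) → v = 0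

section Field

variable (b : OrthonormalBasis (Fin 3) ℂ C3) (r : Fin 3 → ℝ) (α : Fin 3 → ℝ × ℝ →L[ℝ] ℝ)

theorem toricField_add (θ η : Fin 3 → ℂ) (p : ℝ × ℝ) :
    toricField b r α (θ + η) p = toricField b r α θ p + toricField b r α η p := by
  simp only [toricField, Pi.add_apply, add_mul, add_smul, Finset.sum_add_distrib]

theorem toricField_smul (c : ℂ) (θ : Fin 3 → ℂ) (p : ℝ × ℝ) :
    toricField b r α (c • θ) p = c • toricField b r α θ p := by
  simp only [toricField, Pi.smul_apply, smul_eq_mul, Finset.smul_sum, smul_smul, mul_assoc]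

theorem toricField_real_smul (c : ℝ) (θ : Fin 3 → ℂ) (p : ℝ × ℝ) :
    toricField b r α (fun j => c * θ j) p = c • toricField b r α θ p :=
  toricField_smul b r α (c : ℂ) θ p

theorem toricField_sum {ι : Type*} (s : Finset ι) (θ : ι → Fin 3 → ℂ) (p : ℝ × ℝ) :
    toricField b r α (fun j => ∑ i ∈ s, θ i j) p = ∑ i ∈ s, toricField b r α (θ i) p := by
  simp only [toricField]
  rw [Finset.sum_comm]
  simp only [Finset.sum_mul, Finset.sum_smul]

/-- The phases cancel, so products of toric fields do not depend on `p`: the metric quantities below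
are constant. -/
theorem inner_toricField (θ η : Fin 3 → ℂ) (p : ℝ × ℝ) :
    (inner ℂ (toricField b r α θ p) (toricField b r α η p) : ℂ) =
      ∑ j, (starRingEnd ℂ) (θ j) * η j * (r j : ℂ) ^ 2 := by
  rw [toricField, toricField, b.orthonormal.inner_sum]
  refine Finset.sum_congr rfl fun j _ => ?_
  have h := conj_mul_self_of_norm_one (Complex.norm_exp_ofReal_mul_I (α j p))
  simp only [map_mul, Complex.conj_ofReal]
  linear_combination (starRingEnd ℂ) (θ j) * η j * (r j : ℂ) ^ 2 * h

theorem contDiff_toricField (θ : Fin 3 → ℂ) : ContDiff ℝ ∞ (toricField b r α θ) := by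
  unfold toricField
  refine ContDiff.sum fun j _ => ContDiff.fun_smul (contDiff_const.mul (contDiff_const.mul ?_))
    contDiff_const
  exact ((Complex.ofRealCLM.contDiff.comp (α j).contDiff).mul contDiff_const).cexp

theorem fderiv_phase (β : ℝ × ℝ →L[ℝ] ℝ) (p v : ℝ × ℝ) :
    fderiv ℝ (fun q => Complex.exp (β q * Complex.I)) p v =
      β v * Complex.I * Complex.exp (β p * Complex.I) := by
  have h1 : HasFDerivAt (fun q => (β q : ℂ)) (Complex.ofRealCLM.comp β) p :=
    (Complex.ofRealCLM.comp β).hasFDerivAt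
  have h2 := (h1.mul_const Complex.I).cexp
  rw [h2.fderiv]
  simp
  ring

theorem fderiv_toricField (θ : Fin 3 → ℂ) (p v : ℝ × ℝ) :
    fderiv ℝ (toricField b r α θ) p v =
      toricField b r α (fun j => θ j * (α j v * Complex.I)) p := by
  have hd : ∀ j, DifferentiableAt ℝ (fun q => Complex.exp (α j q * Complex.I)) p := fun j =>
    ((Complex.ofRealCLM.differentiable.comp (α j).differentiable p).mul_const _).cexp
  have hd' : ∀ j, DifferentiableAt ℝ
      (fun q => θ j * (r j * Complex.exp (α j q * Complex.I))) p := fun j =>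
    ((hd j).const_mul _).const_mul _
  unfold toricField
  rw [fderiv_fun_sum fun j _ => (hd' j).smul_const _]
  simp only [sum_apply]
  refine Finset.sum_congr rfl fun j _ => ?_
  rw [fderiv_smul_const (hd' j), fderiv_const_mul ((hd j).const_mul _), fderiv_const_mul (hd j)]
  simp only [ContinuousLinearMap.smulRight_apply, smul_apply, fderiv_phase, smul_eq_mul]
  congr 1
  ring

end Field

theorem norm_toricLift_of_sum_sq (b : OrthonormalBasis (Fin 3) ℂ C3) {r : Fin 3 → ℝ}
    (α : Fin 3 → ℝ × ℝ →L[ℝ] ℝ) (h : ∑ j, r j ^ 2 = 1) (p : ℝ × ℝ) :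
    ‖toricLift b r α p‖ = 1 := by
  have h1 := inner_self_eq_norm_sq_to_K (𝕜 := ℂ) (toricLift b r α p)
  rw [toricLift, inner_toricField] at h1
  have h2 : ((∑ j, r j ^ 2 : ℝ) : ℂ) = ((‖toricField b r α 1 p‖ ^ 2 : ℝ) : ℂ) := by
    simpa using h1
  have h3 := Complex.ofReal_injective h2
  rw [h] at h3
  rw [toricLift]
  nlinarith [norm_nonneg (toricField b r α 1 p)]

theorem fderiv_toricLift (b : OrthonormalBasis (Fin 3) ℂ C3) (r : Fin 3 → ℝ)
    (α : Fin 3 → ℝ × ℝ →L[ℝ] ℝ) (p v : ℝ × ℝ) :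
    fderiv ℝ (toricLift b r α) p v = toricField b r α (fun j => α j v * Complex.I) p := by
  rw [toricLift, fderiv_toricField]
  simp

namespace IsToricDatum

variable {b : OrthonormalBasis (Fin 3) ℂ C3} {r : Fin 3 → ℝ} {α : Fin 3 → ℝ × ℝ →L[ℝ] ℝ}

theorem balanced_complex (h : IsToricDatum r α) (v : ℝ × ℝ) :
    ∑ j, (α j v : ℂ) * (r j : ℂ) ^ 2 = 0 := by
  have := congrArg (fun x : ℝ => (x : ℂ)) (h.balanced v)
  simp only [Complex.ofReal_sum, Complex.ofReal_mul, Complex.ofReal_pow, Complex.ofReal_zero] at this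
  rw [← this]
  exact Finset.sum_congr rfl fun j _ => mul_comm _ _

theorem norm_toricLift (h : IsToricDatum r α) (p : ℝ × ℝ) : ‖toricLift b r α p‖ = 1 :=
  norm_toricLift_of_sum_sq b α h.sum_sq p

/-- The lift itself is the field with `θ = 1`, so the projection subtracts from `θ` its mean for the
weights `r_l²`. -/
theorem hor_toricField (θ : Fin 3 → ℂ) (p : ℝ × ℝ) :
    hor (toricLift b r α p) (toricField b r α θ p) =
      toricField b r α (fun j => θ j - ∑ l, θ l * (r l : ℂ) ^ 2) p := by
  have : (fun j => θ j - ∑ l, θ l * (r l : ℂ) ^ 2) =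
      θ + (-∑ l, θ l * (r l : ℂ) ^ 2) • (1 : Fin 3 → ℂ) := by
    ext j; simp [sub_eq_add_neg]
  rw [this, toricField_add, toricField_smul, hor_eq, toricLift, inner_toricField]
  simp [sub_eq_add_neg]

theorem dHor_toricLift (h : IsToricDatum r α) (p v : ℝ × ℝ) :
    dHor (toricLift b r α) p v = toricField b r α (fun j => α j v * Complex.I) p := by
  rw [dHor, toricLift, fderiv_toricField, ← toricLift, hor_toricField]
  congr 1
  ext j
  have : ∑ l, (1 : Fin 3 → ℂ) l * (α l v * Complex.I) * (r l : ℂ) ^ 2 = 0 := by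
    rw [← zero_mul Complex.I, ← h.balanced_complex v, Finset.sum_mul]
    refine Finset.sum_congr rfl fun l _ => ?_
    simp only [Pi.one_apply]; ring
  rw [this]; simp

theorem inner_toricLift_fderiv (h : IsToricDatum r α) (p v : ℝ × ℝ) :
    (inner ℂ (toricLift b r α p) (fderiv ℝ (toricLift b r α) p v) : ℂ) = 0 := by
  rw [fderiv_toricLift, ← h.dHor_toricLift]
  exact inner_hor (h.norm_toricLift p) _

/-- That this product is real is the Lagrangian condition. -/
theorem inner_dHor_toricLift (h : IsToricDatum r α) (p v w : ℝ × ℝ) :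
    (inner ℂ (dHor (toricLift b r α) p v) (dHor (toricLift b r α) p w) : ℂ) =
      (∑ j, r j ^ 2 * α j v * α j w : ℝ) := by
  rw [h.dHor_toricLift, h.dHor_toricLift, inner_toricField]
  push_cast
  refine Finset.sum_congr rfl fun j _ => ?_
  simp only [map_mul, Complex.conj_ofReal, Complex.conj_I]
  linear_combination (-(α j v : ℂ) * α j w * r j ^ 2) * Complex.I_mul_I

/-- The lift is horizontal, so there is no vertical correction: two derivatives multiply the
coefficients by `i α_j w` and `i α_j v`, and the projection removes the mean. -/
theorem covDeriv_toricLift (h : IsToricDatum r α) (p v w : ℝ × ℝ) :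
    covDeriv (toricLift b r α) (fun q => dHor (toricLift b r α) q w) p v =
      toricField b r α
        (fun j => ((-(α j v * α j w - ∑ l, r l ^ 2 * α l v * α l w) : ℝ) : ℂ)) p := by
  have : (fun q => dHor (toricLift b r α) q w) =
      toricField b r α (fun j => α j w * Complex.I) := by
    ext1 q; exact h.dHor_toricLift q w
  rw [this, covDeriv_eq, h.inner_toricLift_fderiv, zero_smul, sub_zero, fderiv_toricField,
    hor_toricField]
  congr 1
  ext j
  have h1 : ∀ l, (α l w : ℂ) * Complex.I * (α l v * Complex.I) = -(α l v * α l w) := fun l => by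
    linear_combination ((α l v : ℂ) * α l w) * Complex.I_mul_I
  simp only [h1]
  push_cast
  rw [neg_sub, sub_eq_neg_add, ← Finset.sum_neg_distrib, sub_eq_add_neg]
  congr 1
  refine Finset.sum_congr rfl fun l _ => by ring

/-- Every angular velocity which is balanced is attained. -/
theorem exists_velocity (h : IsToricDatum r α) {θ : Fin 3 → ℝ} (hθ : ∑ j, r j ^ 2 * θ j = 0) :
    ∃ v, ∀ j, α j v = θ j := by
  let ℓ : (Fin 3 → ℝ) →ₗ[ℝ] ℝ := ∑ j, (r j ^ 2) • LinearMap.proj j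
  have hℓ : ∀ η, ℓ η = ∑ j, r j ^ 2 * η j := fun η => by simp [ℓ]
  let A : ℝ × ℝ →ₗ[ℝ] (Fin 3 → ℝ) := LinearMap.pi fun j => (α j : ℝ × ℝ →ₗ[ℝ] ℝ)
  have hA : A.ker = ⊥ := by
    rw [LinearMap.ker_eq_bot']
    intro v hv
    exact h.injective v fun j => congrFun hv j
  have hle : A.range ≤ ℓ.ker := by
    rintro _ ⟨v, rfl⟩
    rw [LinearMap.mem_ker, hℓ]
    exact h.balanced v
  have hrange : Module.finrank ℝ A.range = 2 := by
    have := LinearMap.finrank_range_add_finrank_ker A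
    rw [hA] at this
    simpa using this
  have hker : Module.finrank ℝ ℓ.ker = 2 := by
    have h1 := LinearMap.finrank_range_add_finrank_ker ℓ
    have h2 : ℓ.range = ⊤ := by
      rw [LinearMap.range_eq_top]
      intro t
      refine ⟨fun _ => t, ?_⟩
      rw [hℓ, ← Finset.sum_mul, h.sum_sq, one_mul]
    rw [h2] at h1
    simp at h1
    omega
  -- Injectivity gives the range dimension 2, and the kernel of a nonzero form on `ℝ³` also has
  -- dimension 2.
  have heq : A.range = ℓ.ker := Submodule.eq_of_le_of_finrank_eq hle (hrange.trans hker.symm)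
  have : θ ∈ A.range := by
    rw [heq, LinearMap.mem_ker, hℓ, hθ]
  obtain ⟨v, hv⟩ := this
  exact ⟨v, fun j => congrFun hv j⟩

/-! ### Induced metric and mean curvature of a toric lift -/

theorem gram_toricLift (h : IsToricDatum r α) (p : ℝ × ℝ) :
    gram (toricLift b r α) p =
      Matrix.of fun i k => ∑ j, r j ^ 2 * α j (coordVec i) * α j (coordVec k) := by
  ext i k
  rw [gram, Matrix.of_apply, Matrix.of_apply, real_inner_eq, h.inner_dHor_toricLift,
    Complex.ofReal_re]

theorem map_eq_sum (β : ℝ × ℝ →L[ℝ] ℝ) (v : ℝ × ℝ) :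
    β v = ∑ i, ![v.1, v.2] i * β (coordVec i) := by
  have : v = v.1 • (1, 0) + v.2 • ((0, 1) : ℝ × ℝ) := by ext <;> simp
  conv_lhs => rw [this]
  rw [map_add, map_smul, map_smul]
  simp [Fin.sum_univ_two, coordVec]

theorem gram_mulVec (h : IsToricDatum r α) (p v : ℝ × ℝ) :
    (gram (toricLift b r α) p).mulVec ![v.1, v.2] =
      fun i => ∑ j, r j ^ 2 * α j (coordVec i) * α j v := by
  ext i
  rw [h.gram_toricLift, Matrix.mulVec, dotProduct]
  simp only [Matrix.of_apply, Finset.sum_mul]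
  rw [Finset.sum_comm]
  refine Finset.sum_congr rfl fun j _ => ?_
  rw [map_eq_sum (α j) v, Finset.mul_sum]
  refine Finset.sum_congr rfl fun k _ => by ring

theorem gram_posDef (h : IsToricDatum r α) (p : ℝ × ℝ) :
    (gram (toricLift b r α) p).PosDef := by
  refine Matrix.PosDef.of_dotProduct_mulVec_pos ?_ ?_
  · ext i k
    rw [Matrix.conjTranspose_apply, h.gram_toricLift, Matrix.of_apply, Matrix.of_apply, star_trivial]
    exact Finset.sum_congr rfl fun j _ => by ring
  · intro x hx
    set v : ℝ × ℝ := (x 0, x 1)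
    have hxv : x = ![v.1, v.2] := by ext i; fin_cases i <;> rfl
    have hv : v ≠ 0 := by
      rintro hv
      apply hx
      rw [hxv, hv]
      ext i; fin_cases i <;> rfl
    have key : star x ⬝ᵥ (gram (toricLift b r α) p).mulVec x = ∑ j, r j ^ 2 * α j v ^ 2 := by
      rw [hxv, h.gram_mulVec, star_trivial, dotProduct]
      simp only [Finset.mul_sum]
      rw [Finset.sum_comm]
      refine Finset.sum_congr rfl fun j _ => ?_
      rw [pow_two (α j v)]
      nth_rw 2 [map_eq_sum (α j) v]
      rw [Finset.sum_mul, Finset.mul_sum]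
      refine Finset.sum_congr rfl fun k _ => by ring
    rw [key]
    have : ∃ j, α j v ≠ 0 := by
      by_contra! hc
      exact hv (h.injective v hc)
    obtain ⟨j, hj⟩ := this
    refine Finset.sum_pos' (fun j _ => by positivity) ⟨j, Finset.mem_univ _, ?_⟩
    have := h.pos j
    positivity

theorem areaDensity_toricLift_pos (h : IsToricDatum r α) (p : ℝ × ℝ) :
    0 < areaDensity (toricLift b r α) p :=
  Real.sqrt_pos.2 (h.gram_posDef p).det_pos

theorem areaDensity_toricLift (h : IsToricDatum r α) (p q : ℝ × ℝ) :
    areaDensity (toricLift b r α) p = areaDensity (toricLift b r α) q := by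
  rw [areaDensity, areaDensity, h.gram_toricLift, h.gram_toricLift]

/-- This is the squared norm of `α k` for the induced metric. Its dual vector is the `v` whose
velocity is the balanced projection of the `k`-th basis vector divided by `r k ^ 2`; evaluating `α
k` on it gives the value. -/
theorem sum_gram_inv (h : IsToricDatum r α) (p : ℝ × ℝ) (k : Fin 3) :
    ∑ i, ∑ j, (gram (toricLift b r α) p)⁻¹ i j * (α k (coordVec i) * α k (coordVec j)) =
      1 / r k ^ 2 - 1 := by
  have hk := (h.pos k).ne'
  obtain ⟨v, hv⟩ := h.exists_velocity (θ := fun l => (if l = k then 1 / r k ^ 2 else 0) - 1) (by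
    simp only [mul_sub, mul_one, Finset.sum_sub_distrib, h.sum_sq, mul_ite, mul_zero,
      Finset.sum_ite_eq', Finset.mem_univ, if_true]
    field_simp
    ring)
  have hG : (gram (toricLift b r α) p).mulVec ![v.1, v.2] = fun i => α k (coordVec i) := by
    rw [h.gram_mulVec]
    ext i
    simp only [hv, mul_sub, mul_one, Finset.sum_sub_distrib, h.balanced, mul_ite, mul_zero,
      Finset.sum_ite_eq', Finset.mem_univ, if_true]
    field_simp
    ring
  have hu : IsUnit (gram (toricLift b r α) p).det := (h.gram_posDef p).det_pos.ne'.isUnit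
  have hinv : (gram (toricLift b r α) p)⁻¹.mulVec (fun i => α k (coordVec i)) = ![v.1, v.2] := by
    rw [← hG, Matrix.mulVec_mulVec, Matrix.nonsing_inv_mul _ hu, Matrix.one_mulVec]
  have h1 : α k v = 1 / r k ^ 2 - 1 := by rw [hv]; simp
  rw [← h1, map_eq_sum (α k) v, ← hinv]
  refine Finset.sum_congr rfl fun i _ => ?_
  rw [Matrix.mulVec, dotProduct, Finset.sum_mul]
  refine Finset.sum_congr rfl fun j _ => by ring

/-- The covariant derivative has real coefficients and tangent vectors have imaginary ones, so it is
already normal. -/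
theorem secondFF_toricLift (h : IsToricDatum r α) (p : ℝ × ℝ) (i j : Fin 2) :
    secondFF (toricLift b r α) p i j =
      toricField b r α (fun k => ((-(α k (coordVec i) * α k (coordVec j) -
        ∑ l, r l ^ 2 * α l (coordVec i) * α l (coordVec j)) : ℝ) : ℂ)) p := by
  rw [secondFF, h.covDeriv_toricLift, normalPart]
  have : ∀ (θ : Fin 3 → ℝ) (k : Fin 2),
      inner ℝ (toricField b r α (fun j => (θ j : ℂ)) p) (dHor (toricLift b r α) p (coordVec k))
        = 0 := by
    intro θ k
    rw [real_inner_eq, h.dHor_toricLift, inner_toricField, Complex.re_sum]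
    refine Finset.sum_eq_zero fun l _ => ?_
    rw [Complex.conj_ofReal, ← Complex.ofReal_pow, Complex.re_mul_ofReal, Complex.re_ofReal_mul,
      Complex.re_ofReal_mul, Complex.I_re]
    simp
  simp only [this, mul_zero, zero_smul, Finset.sum_const_zero, sub_zero]

theorem meanCurvature_toricLift (h : IsToricDatum r α) (p : ℝ × ℝ) :
    meanCurvature (toricLift b r α) p =
      toricField b r α (fun k => (((3 - 1 / r k ^ 2) / 2 : ℝ) : ℂ)) p := by
  rw [meanCurvature]
  simp only [h.secondFF_toricLift, ← toricField_real_smul, ← toricField_sum]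
  congr 1
  ext k
  norm_cast
  -- The trace of the metric with respect to itself, found by summing `sum_gram_inv` with weights `r
  -- l ^ 2`: three terms `1` minus the sum of the squared radii.
  have h2 : ∑ i, ∑ j, (gram (toricLift b r α) p)⁻¹ i j *
      ∑ l, r l ^ 2 * α l (coordVec i) * α l (coordVec j) = 2 := by
    have : ∑ l, r l ^ 2 * (1 / r l ^ 2 - 1) = 2 := by
      have h3 : ∀ l, r l ^ 2 * (1 / r l ^ 2 - 1) = 1 - r l ^ 2 := fun l => by
        have := (h.pos l).ne'
        field_simp
      simp only [h3, Finset.sum_sub_distrib, h.sum_sq]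
      simp; norm_num
    rw [← this]
    simp only [← h.sum_gram_inv (b := b) p, Finset.mul_sum]
    rw [Finset.sum_comm' (t' := Finset.univ) (s' := fun _ => Finset.univ) (by simp)]
    conv_rhs => rw [Finset.sum_comm]
    rw [Finset.sum_comm]
    refine Finset.sum_congr rfl fun i _ => ?_
    rw [Finset.sum_comm]
    refine Finset.sum_congr rfl fun l _ => Finset.sum_congr rfl fun j _ => by ring
  have h4 := h.sum_gram_inv (b := b) p k
  simp only [neg_sub, mul_sub, Finset.sum_sub_distrib, h2, h4]
  ring

end IsToricDatum

theorem eq_inv_sqrt_three_iff {x : ℝ} (hx : 0 < x) : x = 1 / √3 ↔ 1 / x ^ 2 = 3 := by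
  have h3 : √3 ^ 2 = (3 : ℝ) := Real.sq_sqrt (by norm_num)
  have hpos : 0 < √(3 : ℝ) := Real.sqrt_pos.2 (by norm_num)
  constructor
  · rintro rfl
    rw [div_pow, h3]; norm_num
  · intro h
    rw [eq_div_iff hpos.ne']
    have h1 : 1 = 3 * x ^ 2 := by
      field_simp at h
      linarith
    have h2 : (x * √3) ^ 2 = 1 := by rw [mul_pow, h3]; linarith
    nlinarith [mul_pos hx hpos]

/-! ### Functions on the projective plane -/

theorem onC3_smul (h : CP2 → ℝ) {a : ℂ} (ha : a ≠ 0) (z : C3) : onC3 h (a • z) = onC3 h z := by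
  by_cases hz : z = 0
  · simp [hz]
  · have haz : a • z ≠ 0 := smul_ne_zero ha hz
    rw [onC3, onC3, dif_pos haz, dif_pos hz]
    congr 1
    exact (Projectivization.mk_eq_mk_iff' ℂ _ _ _ _).2 ⟨a, rfl⟩

theorem onC3_of_lifts (h : CP2 → ℝ) {U : ℝ × ℝ → CP2} {W : Set (ℝ × ℝ)} {f : ℝ × ℝ → C3}
    (hf : IsLift U W f) {p : ℝ × ℝ} (hp : p ∈ W) : onC3 h (f p) = h (U p) := by
  obtain ⟨h1, h2⟩ := hf.lifts p hp
  have h3 : f p ≠ 0 := ne_zero_of_mem_unit_sphere ⟨f p, h1⟩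
  rw [onC3, dif_pos h3, ← h2]
  rfl

theorem SmoothFun.differentiableAt {h : CP2 → ℝ} (hh : SmoothFun h) {z : C3} (hz : z ≠ 0) :
    DifferentiableAt ℝ (onC3 h) z :=
  (hh.contDiffAt (isOpen_compl_singleton.mem_nhds hz)).differentiableAt (by simp)

/-- Differentiates the homogeneity of degree zero; it moves the first variation from an arbitrary
lift to the toric one. -/
theorem fderiv_onC3_smul {h : CP2 → ℝ} (hh : SmoothFun h) {a : ℂ} (ha : a ≠ 0) {z : C3}
    (hz : z ≠ 0) (X : C3) : fderiv ℝ (onC3 h) (a • z) (a • X) = fderiv ℝ (onC3 h) z X := by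
  have h1 : (fun w : C3 => onC3 h (a • w)) = onC3 h := funext fun w => onC3_smul h ha w
  have h2 : HasFDerivAt (fun w : C3 => a • w) (a • ContinuousLinearMap.id ℝ C3) z :=
    (hasFDerivAt_id z).const_smul a
  have h3 := (hh.differentiableAt (smul_ne_zero ha hz)).hasFDerivAt.comp z h2
  have h4 : fderiv ℝ (onC3 h) z = (fderiv ℝ (onC3 h) (a • z)).comp
      (a • ContinuousLinearMap.id ℝ C3) := by
    rw [← h3.fderiv]
    conv_lhs => rw [← h1]
    rfl
  rw [h4]
  rfl

/-- The pairing of the mean curvature with a Hamiltonian field becomes a derivative of `h` in the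
direction of `i` times the mean curvature. -/
theorem inner_hamiltonianField (h : CP2 → ℝ) (z X : C3) :
    inner ℝ X (hamiltonianField h z) = -fderiv ℝ (onC3 h) z (Complex.I • X) := by
  have h1 : fderiv ℝ (onC3 h) z (Complex.I • X) =
      inner ℝ (gradient (onC3 h) z) (Complex.I • X) := by
    rw [← toDual_gradient, InnerProductSpace.toDual_apply_apply]
  rw [h1, real_inner_comm, hamiltonianField, real_inner_eq, real_inner_eq, inner_smul_left,
    inner_smul_right]
  simp

/-! ### Maps with a toric lift -/

section Gauge

variable {W : Set (ℝ × ℝ)} {c : ℝ × ℝ → ℂ} {f g : ℝ × ℝ → C3}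

theorem IsGauge.fderiv_fun_eq_zero (h : IsGauge W c f g) (hf : IsLegendrian W f)
    (hg : IsLegendrian W g) {p : ℝ × ℝ} (hp : p ∈ W) : fderiv ℝ c p = 0 := by
  refine ContinuousLinearMap.ext fun v => ?_
  have h1 : (inner ℂ (f p) (fderiv ℝ f p v) : ℂ) = 0 := hf p hp v
  have h2 : (inner ℂ (g p) (fderiv ℝ g p v) : ℂ) = 0 := hg p hp v
  have hc : c p ≠ 0 := norm_pos_iff.1 (by rw [h.norm_fun p hp]; exact one_pos)
  rw [h.fderiv_eq hp, h.eq p hp, inner_add_right, inner_smul_left, inner_smul_left,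
    inner_smul_right, inner_smul_right, h2, inner_self_of_norm_one (h.norm p hp)] at h1
  simpa [hc] using h1

/-- Between horizontal lifts the phase has zero derivative, so each of the three rows of the
determinant is multiplied by `c p`. -/
theorem IsGauge.expLagrangianAngle_eq (h : IsGauge W c f g) (hf : IsLegendrian W f)
    (hg : IsLegendrian W g) {p : ℝ × ℝ} (hp : p ∈ W) :
    expLagrangianAngle f p = c p ^ 3 * expLagrangianAngle g p := by
  have h1 : ∀ v, fderiv ℝ f p v = c p • fderiv ℝ g p v := fun v => by
    rw [h.fderiv_eq hp, h.fderiv_fun_eq_zero hf hg hp]; simp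
  rw [expLagrangianAngle, expLagrangianAngle, h.areaDensity_eq hp, h1, h1, h.eq p hp,
    mul_div_assoc']
  congr 1
  have : (Matrix.of fun a b : Fin 3 => (![c p • g p, c p • fderiv ℝ g p (coordVec 0),
      c p • fderiv ℝ g p (coordVec 1)] a : C3) b) = c p • (Matrix.of fun a b : Fin 3 =>
      (![g p, fderiv ℝ g p (coordVec 0), fderiv ℝ g p (coordVec 1)] a : C3) b) := by
    ext a b
    fin_cases a <;> simp
  rw [this, Matrix.det_smul, Fintype.card_fin]

end Gauge

namespace IsToricDatum

variable {b : OrthonormalBasis (Fin 3) ℂ C3} {r : Fin 3 → ℝ} {α : Fin 3 → ℝ × ℝ →L[ℝ] ℝ}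
  {U : ℝ × ℝ → CP2}

theorem eq_zero_of_toricField_eq_zero (h : IsToricDatum r α) {θ : Fin 3 → ℂ} {p : ℝ × ℝ}
    (h0 : toricField b r α θ p = 0) (k : Fin 3) : θ k = 0 := by
  have h1 := inner_toricField b r α (Pi.single k 1) θ p
  rw [h0, inner_zero_right, Finset.sum_eq_single k (by intro j _ hj; simp [hj]) (by simp)] at h1
  have := (h.pos k).ne'
  simpa [this] using h1

theorem injective_dHor (h : IsToricDatum r α) (p : ℝ × ℝ) :
    Function.Injective (dHor (toricLift b r α) p) := by
  intro v w hvw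
  have h1 : toricField b r α (fun j => α j (v - w) * Complex.I) p = 0 := by
    rw [← h.dHor_toricLift]
    rw [dHor, map_sub, sub_eq_add_neg, hor_add, ← neg_one_smul ℂ, hor_smul, neg_one_smul,
      ← sub_eq_add_neg, sub_eq_zero]
    exact hvw
  rw [← sub_eq_zero]
  refine h.injective _ fun j => ?_
  exact Complex.ofReal_eq_zero.1
    ((mul_eq_zero.1 (h.eq_zero_of_toricField_eq_zero h1 j)).resolve_right Complex.I_ne_zero)

theorem isLagrangianImmersion (h : IsToricDatum r α)
    (hU : IsLift U Set.univ (toricLift b r α)) : IsLagrangianImmersion U := by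
  refine ⟨⟨fun p => ⟨_, _, Set.mem_univ p, hU⟩, fun W f hf p hp => ?_⟩,
    fun W f hf p hp v w => ?_⟩
  · have hG := hf.isGauge hU
    have hp' : p ∈ W ∩ Set.univ := ⟨hp, Set.mem_univ p⟩
    have : (dHor f p) = fun v => _ • dHor (toricLift b r α) p v := funext (hG.dHor_eq hp')
    rw [this]
    have hc := norm_pos_iff.1 ((hG.norm_fun p hp').symm ▸ one_pos)
    exact (smul_right_injective C3 hc).comp (h.injective_dHor p)
  · have hG := hf.isGauge hU
    have hp' : p ∈ W ∩ Set.univ := ⟨hp, Set.mem_univ p⟩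
    rw [kahler_eq, hG.dHor_eq hp', hG.dHor_eq hp', inner_smul_smul (hG.norm_fun p hp'),
      h.inner_dHor_toricLift, Complex.ofReal_im, neg_zero]

theorem meanCurvature_eq_zero_iff (h : IsToricDatum r α) (p : ℝ × ℝ) :
    meanCurvature (toricLift b r α) p = 0 ↔ ∀ i, r i = 1 / √3 := by
  simp only [eq_inv_sqrt_three_iff (h.pos _)]
  rw [h.meanCurvature_toricLift]
  constructor
  · intro h0 i
    have := h.eq_zero_of_toricField_eq_zero h0 i
    have := Complex.ofReal_eq_zero.1 this
    linarith
  · intro hr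
    simp [toricField, hr]

theorem isMinimal_iff (h : IsToricDatum r α) {u : Torus → CP2}
    (hU : IsLift (onPlane u) Set.univ (toricLift b r α)) :
    IsMinimal u ↔ ∀ i, r i = 1 / √3 := by
  constructor
  · intro hm
    exact (h.meanCurvature_eq_zero_iff 0).1 (hm _ _ hU 0 (Set.mem_univ _))
  · intro hr W f hf p hp
    rw [(hf.isGauge hU).meanCurvature_eq ⟨hp, Set.mem_univ p⟩,
      (h.meanCurvature_eq_zero_iff p).2 hr, smul_zero]

/-! ### Lagrangian angle of a toric lift -/

theorem isLegendrian_toricLift (h : IsToricDatum r α) (W : Set (ℝ × ℝ)) :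
    IsLegendrian W (toricLift b r α) :=
  fun p _ v => h.inner_toricLift_fderiv p v

theorem toricFrame_apply (p : ℝ × ℝ) (a k : Fin 3) :
    (![toricLift b r α p, fderiv ℝ (toricLift b r α) p (coordVec 0),
      fderiv ℝ (toricLift b r α) p (coordVec 1)] a : C3) k =
    ((Matrix.of ![1, fun j => (α j (coordVec 0) * Complex.I : ℂ),
        fun j => (α j (coordVec 1) * Complex.I : ℂ)] *
      Matrix.diagonal fun j => (r j * Complex.exp (α j p * Complex.I) : ℂ)) *
      Matrix.of fun j k => b j k : Matrix (Fin 3) (Fin 3) ℂ) a k := by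
  rw [Matrix.mul_apply]
  simp only [Matrix.mul_diagonal]
  fin_cases a
  · simp [toricLift, toricField]
  · simp [fderiv_toricLift, toricField]
  · simp [fderiv_toricLift, toricField]

/-- In the factorization velocities, diagonal, basis, only the diagonal factor depends on `p`,
through the product of the phases. -/
theorem det_toricFrame (p : ℝ × ℝ) :
    (Matrix.of fun a k : Fin 3 =>
      (![toricLift b r α p, fderiv ℝ (toricLift b r α) p (coordVec 0),
      fderiv ℝ (toricLift b r α) p (coordVec 1)] a : C3) k).det =
    (Matrix.of ![1, fun j => (α j (coordVec 0) * Complex.I : ℂ),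
        fun j => (α j (coordVec 1) * Complex.I : ℂ)]).det * (∏ j, (r j : ℂ)) *
      (Matrix.of fun j k => b j k).det * Complex.exp ((∑ j, α j) p * Complex.I) := by
  have : (Matrix.of fun a k : Fin 3 =>
      (![toricLift b r α p, fderiv ℝ (toricLift b r α) p (coordVec 0),
      fderiv ℝ (toricLift b r α) p (coordVec 1)] a : C3) k) = _ :=
    Matrix.ext fun a k => toricFrame_apply p a k
  rw [this, Matrix.det_mul, Matrix.det_mul, Matrix.det_diagonal, Finset.prod_mul_distrib,
    ← Complex.exp_sum, ← Finset.sum_mul]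
  simp only [sum_apply, Complex.ofReal_sum]
  ring

/-- A linear relation between the rows vanishes coefficient by coefficient. Its weighted mean
isolates `x 0`; the real and imaginary parts of the rest are vectors killed by every `α j`. -/
theorem det_toricFrame_ne_zero (h : IsToricDatum r α) (p : ℝ × ℝ) :
    (Matrix.of fun a k : Fin 3 =>
      (![toricLift b r α p, fderiv ℝ (toricLift b r α) p (coordVec 0),
      fderiv ℝ (toricLift b r α) p (coordVec 1)] a : C3) k).det ≠ 0 := by
  rw [Ne, ← Matrix.exists_vecMul_eq_zero_iff]
  rintro ⟨x, hx, h0⟩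
  have h1 : toricField b r α (fun j => x 0 + x 1 * (α j (coordVec 0) * Complex.I) +
      x 2 * (α j (coordVec 1) * Complex.I)) p = 0 := by
    have h2 : (fun j => x 0 + x 1 * (α j (coordVec 0) * Complex.I) +
        x 2 * (α j (coordVec 1) * Complex.I)) = x 0 • (1 : Fin 3 → ℂ) +
        x 1 • (fun j => (α j (coordVec 0) * Complex.I)) +
        x 2 • (fun j => (α j (coordVec 1) * Complex.I)) := by
      ext j; simp
    rw [h2, toricField_add, toricField_add, toricField_smul, toricField_smul, toricField_smul,
      ← fderiv_toricLift, ← fderiv_toricLift, ← toricLift]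
    ext k
    have := congrFun h0 k
    simpa [Matrix.vecMul, dotProduct, Fin.sum_univ_three] using this
  have h3 := fun j => h.eq_zero_of_toricField_eq_zero h1 j
  have hs : ∑ j, (r j : ℂ) ^ 2 = 1 := by exact_mod_cast congrArg (fun t : ℝ => (t : ℂ)) h.sum_sq
  have hx0 : x 0 = 0 := by
    have h4 : ∑ j, (x 0 + x 1 * (α j (coordVec 0) * Complex.I) +
        x 2 * (α j (coordVec 1) * Complex.I)) * (r j : ℂ) ^ 2 = 0 :=
      Finset.sum_eq_zero fun j _ => by rw [h3 j, zero_mul]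
    have h5 := h.balanced_complex (coordVec 0)
    have h6 := h.balanced_complex (coordVec 1)
    simp only [Fin.sum_univ_three] at h4 h5 h6 hs
    linear_combination h4 - x 1 * Complex.I * h5 - x 2 * Complex.I * h6 - x 0 * hs
  have hv : ∀ j, (x 1 * α j (coordVec 0) + x 2 * α j (coordVec 1) : ℂ) = 0 := fun j => by
    have := h3 j
    rw [hx0, zero_add, ← mul_assoc, ← mul_assoc, ← add_mul] at this
    simpa using this
  have hre : ((x 1).re, (x 2).re) = (0 : ℝ × ℝ) := by
    refine h.injective _ fun j => ?_
    rw [map_eq_sum]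
    simpa [Fin.sum_univ_two] using congrArg Complex.re (hv j)
  have him : ((x 1).im, (x 2).im) = (0 : ℝ × ℝ) := by
    refine h.injective _ fun j => ?_
    rw [map_eq_sum]
    simpa [Fin.sum_univ_two] using congrArg Complex.im (hv j)
  apply hx
  rw [Prod.ext_iff] at hre him
  ext j
  fin_cases j
  · exact hx0
  · exact Complex.ext hre.1 him.1
  · exact Complex.ext hre.2 him.2

theorem expLagrangianAngle_toricLift (h : IsToricDatum r α) (p : ℝ × ℝ) :
    expLagrangianAngle (toricLift b r α) p =
      expLagrangianAngle (toricLift b r α) 0 * Complex.exp ((∑ j, α j) p * Complex.I) := by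
  rw [expLagrangianAngle, expLagrangianAngle, det_toricFrame, det_toricFrame,
    h.areaDensity_toricLift p 0]
  simp
  ring

/-- The angle is constant exactly when `∑ α_j = 0`. If all `r_j²` are `1/3`, this is the balancing
condition; conversely, evaluating it on suitable velocities determines each radius. -/
theorem isSpecialLagrangian_iff (h : IsToricDatum r α) {u : Torus → CP2}
    (hU : IsLift (onPlane u) Set.univ (toricLift b r α)) :
    IsSpecialLagrangian u ↔ ∀ i, r i = 1 / √3 := by
  constructor
  · intro hs
    obtain ⟨c, hc⟩ := hs _ _ hU (h.isLegendrian_toricLift _) isPreconnected_univ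
    have h0 : expLagrangianAngle (toricLift b r α) 0 ≠ 0 :=
      div_ne_zero (h.det_toricFrame_ne_zero 0)
        (Complex.ofReal_ne_zero.2 (h.areaDensity_toricLift_pos 0).ne')
    have h1 : (fun q => Complex.exp ((∑ j, α j) q * Complex.I)) = fun _ => 1 := by
      ext1 q
      have h2 := (hc q (Set.mem_univ _)).trans (hc 0 (Set.mem_univ _)).symm
      rw [h.expLagrangianAngle_toricLift q] at h2
      exact mul_left_cancel₀ h0 (h2.trans (mul_one _).symm)
    have h2 : ∀ v, (∑ j, α j) v = 0 := fun v => by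
      have := fderiv_phase (∑ j, α j) 0 v
      rw [h1] at this
      rw [fderiv_fun_const] at this
      have h3 : (((∑ j, α j) v : ℝ) : ℂ) = 0 := by simpa using this.symm
      exact Complex.ofReal_eq_zero.1 h3
    intro i
    rw [eq_inv_sqrt_three_iff (h.pos i)]
    have hi := (h.pos i).ne'
    -- On this balanced velocity the sum of the `α_j` is `1 / r i ^ 2 - 3`.
    obtain ⟨v, hv⟩ := h.exists_velocity (θ := fun l => (if l = i then 1 / r i ^ 2 else 0) - 1) (by
      simp only [mul_sub, mul_one, Finset.sum_sub_distrib, h.sum_sq, mul_ite, mul_zero,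
        Finset.sum_ite_eq', Finset.mem_univ, if_true]
      field_simp
      ring)
    have h3 := h2 v
    simp only [sum_apply, hv, Finset.sum_sub_distrib, Finset.sum_ite_eq', Finset.mem_univ,
      if_true, Finset.sum_const, Finset.card_univ, Fintype.card_fin] at h3
    simp only [nsmul_eq_mul, mul_one, Nat.cast_ofNat] at h3
    linarith
  · intro hr W f hf hleg hW
    have hG := hf.isGauge hU
    rw [Set.inter_univ] at hG
    have hL : IsLegendrian W (toricLift b r α) := h.isLegendrian_toricLift W
    obtain ⟨a, ha⟩ := hG.isOpen.exists_is_const_of_fderiv_eq_zero hW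
      (fun p hp => (hG.differentiableAt_fun hp).differentiableWithinAt)
      (fun p hp => hG.fderiv_fun_eq_zero hleg hL hp)
    refine ⟨a ^ 3 * expLagrangianAngle (toricLift b r α) 0, fun p hp => ?_⟩
    rw [hG.expLagrangianAngle_eq hleg hL hp, ha p hp, h.expLagrangianAngle_toricLift p]
    have : (∑ j, α j) p = 0 := by
      have h1 := h.balanced p
      have h2 : ∀ j, r j ^ 2 = 1 / 3 := fun j => by
        rw [← (eq_inv_sqrt_three_iff (h.pos j)).1 (hr j), one_div_one_div]
      simp only [h2, ← Finset.mul_sum] at h1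
      rw [sum_apply]
      linarith
    rw [this]
    simp

/-! ### Hamiltonian stationarity -/

/-- The coefficients of the mean curvature are balanced, hence are the velocity of a constant
vector; `i` times the mean curvature is then its image under the differential of the lift. -/
theorem exists_variationDensity_eq (h : IsToricDatum r α)
    (hU : IsLift U Set.univ (toricLift b r α)) :
    ∃ v : ℝ × ℝ, ∀ k : CP2 → ℝ, SmoothFun k → ∀ p,
      variationDensity U k p = fderiv ℝ (fun q => k (U q)) p v := by
  obtain ⟨v, hv⟩ := h.exists_velocity (θ := fun j => (3 - 1 / r j ^ 2) / 2) (by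
    have h3 : ∀ l, r l ^ 2 * ((3 - 1 / r l ^ 2) / 2) = 3 / 2 * r l ^ 2 - 1 / 2 := fun l => by
      have := (h.pos l).ne'
      field_simp
    simp only [h3, Finset.sum_sub_distrib, ← Finset.mul_sum, h.sum_sq]
    simp; norm_num)
  -- The sign comes from `inner_hamiltonianField`; the area density is constant, so its value at `0`
  -- serves everywhere.
  refine ⟨-(areaDensity (toricLift b r α) 0) • v, fun k hk p => ?_⟩
  obtain ⟨W, hpW, hf⟩ : ∃ W, p ∈ W ∧ IsLift U W (someLift U p) :=
    Classical.epsilon_spec (p := fun f => ∃ W, p ∈ W ∧ IsLift U W f)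
      ⟨_, Set.univ, Set.mem_univ p, hU⟩
  obtain ⟨c, hG⟩ : ∃ c, IsGauge (W ∩ Set.univ) c (someLift U p) (toricLift b r α) :=
    ⟨_, hf.isGauge hU⟩
  have hp' : p ∈ W ∩ Set.univ := ⟨hpW, Set.mem_univ p⟩
  have hc := norm_pos_iff.1 ((hG.norm_fun p hp').symm ▸ one_pos)
  have hz : toricLift b r α p ≠ 0 := norm_pos_iff.1 ((h.norm_toricLift p).symm ▸ one_pos)
  have hI : Complex.I • meanCurvature (toricLift b r α) p = fderiv ℝ (toricLift b r α) p v := by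
    rw [h.meanCurvature_toricLift, fderiv_toricLift, ← toricField_smul]
    congr 1
    ext j
    rw [hv, Pi.smul_apply, smul_eq_mul, mul_comm]
  have hφ : (fun q => k (U q)) = onC3 k ∘ toricLift b r α :=
    funext fun q => (onC3_of_lifts k hU (Set.mem_univ q)).symm
  have hF : DifferentiableAt ℝ (toricLift b r α) p := hG.differentiableAt hp'
  rw [variationDensity, inner_hamiltonianField, hG.meanCurvature_eq hp', hG.eq p hp',
    hG.areaDensity_eq hp', smul_comm, fderiv_onC3_smul hk hc hz, hI, hφ,
    fderiv_comp p (hk.differentiableAt hz) hF, h.areaDensity_toricLift p 0]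
  simp
  ring

end IsToricDatum

/-- The integrand is the divergence of `(v.1 φ, v.2 φ)`, and the boundary terms on opposite sides
cancel by periodicity. -/
theorem integral_fderiv_eq_zero_of_periodic {φ : ℝ × ℝ → ℝ} (hφ : ContDiff ℝ 1 φ) {T : ℝ}
    (h1 : ∀ y, φ (T, y) = φ (0, y)) (h2 : ∀ x, φ (x, T) = φ (x, 0)) (v : ℝ × ℝ) :
    ∫ x in (0 : ℝ)..T, ∫ y in (0 : ℝ)..T, fderiv ℝ φ (x, y) v = 0 := by
  have hd : ∀ p, HasFDerivAt φ (fderiv ℝ φ p) p := fun p =>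
    (hφ.differentiable (by simp) p).hasFDerivAt
  have hv : ∀ p, fderiv ℝ φ p v = (v.1 • fderiv ℝ φ p) (1, 0) + (v.2 • fderiv ℝ φ p) (0, 1) := by
    intro p
    have : v = v.1 • (1, 0) + v.2 • ((0, 1) : ℝ × ℝ) := by ext <;> simp
    conv_lhs => rw [this]
    rw [map_add, map_smul, map_smul]
    rfl
  simp only [hv]
  have hcont : Continuous fun p => fderiv ℝ φ p := hφ.continuous_fderiv (by simp)
  rw [MeasureTheory.integral2_divergence_prod_of_hasFDerivAt (fun p => v.1 • φ p)
    (fun p => v.2 • φ p) (fun p => v.1 • fderiv ℝ φ p) (fun p => v.2 • fderiv ℝ φ p) 0 0 T T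
    (hφ.continuous.const_smul v.1).continuousOn (hφ.continuous.const_smul v.2).continuousOn
    (fun p _ => (hd p).const_smul v.1) (fun p _ => (hd p).const_smul v.2)]
  · simp [h1, h2]
  · refine ContinuousOn.integrableOn_compact (isCompact_uIcc.prod isCompact_uIcc) ?_
    exact (((hcont.const_smul v.1).clm_apply continuous_const).add
      ((hcont.const_smul v.2).clm_apply continuous_const)).continuousOn

theorem IsToricDatum.isHamiltonianStationary {b : OrthonormalBasis (Fin 3) ℂ C3} {r : Fin 3 → ℝ}
    {α : Fin 3 → ℝ × ℝ →L[ℝ] ℝ} (h : IsToricDatum r α) {u : Torus → CP2}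
    (hU : IsLift (onPlane u) Set.univ (toricLift b r α)) : IsHamiltonianStationary u := by
  intro k hk
  obtain ⟨v, hv⟩ := h.exists_variationDensity_eq hU
  simp only [hv k hk]
  have hφ : (fun q => k (onPlane u q)) = onC3 k ∘ toricLift b r α :=
    funext fun q => (onC3_of_lifts k hU (Set.mem_univ q)).symm
  refine integral_fderiv_eq_zero_of_periodic ?_ (fun y => ?_) (fun x => ?_) v
  · rw [hφ, contDiff_iff_contDiffAt]
    intro p
    have hz : toricLift b r α p ≠ 0 := norm_pos_iff.1 ((h.norm_toricLift p).symm ▸ one_pos)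
    exact ((hk.contDiffAt (isOpen_compl_singleton.mem_nhds hz)).comp p
      (contDiff_toricField b r α 1).contDiffAt).of_le (by simp)
  · simp [onPlane, AddCircle.coe_period]
  · simp [onPlane, AddCircle.coe_period]

/-! ### Linear flows -/

open scoped Matrix.Norms.Operator in
theorem toEuclideanLin_exp (A : Matrix (Fin 3) (Fin 3) ℂ) (w : C3) :
    Matrix.toEuclideanLin (NormedSpace.exp A) w =
      NormedSpace.exp (Matrix.toEuclideanCLM (n := Fin 3) (𝕜 := ℂ) A) w := by
  have hc : Continuous (Matrix.toEuclideanCLM (n := Fin 3) (𝕜 := ℂ)) :=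
    LinearMap.continuous_of_finiteDimensional
      (Matrix.toEuclideanCLM (n := Fin 3) (𝕜 := ℂ)).toAlgEquiv.toLinearMap
  have := NormedSpace.map_exp (Matrix.toEuclideanCLM (n := Fin 3) (𝕜 := ℂ)) hc A
  rw [← this]
  rfl

section Flow

variable {E : Type*} [NormedAddCommGroup E] [NormedSpace ℂ E]

/-- The flow of the linear vector field `T`. -/
def flow (T : E →L[ℂ] E) (t : ℝ) : E →L[ℂ] E := NormedSpace.exp ((t : ℂ) • T)

theorem flow_zero (T : E →L[ℂ] E) : flow T 0 = 1 := by simp [flow]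

theorem hasDerivAt_clm_apply (T : E →L[ℂ] E) {γ : ℝ → E} {γ' : E}
    (hγ : HasDerivAt γ γ' 0) : HasDerivAt (fun t => T (γ t)) (T γ') 0 :=
  (T.restrictScalars ℝ).hasFDerivAt.comp_hasDerivAt _ hγ

variable [FiniteDimensional ℂ E]

theorem flow_neg_flow (T : E →L[ℂ] E) (t : ℝ) (w : E) : flow T (-t) (flow T t w) = w := by
  have : CompleteSpace E := FiniteDimensional.complete ℂ E
  have : flow T (-t) * flow T t = 1 := by
    let _ : NormedAlgebra ℚ (E →L[ℂ] E) := NormedAlgebra.restrictScalars ℚ ℂ _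
    rw [flow, flow, ← NormedSpace.exp_add_of_commute]
    · simp
    · exact ((Commute.refl T).smul_left _).smul_right _
  exact congrArg (fun S : E →L[ℂ] E => S w) this

theorem hasDerivAt_flow (T : E →L[ℂ] E) : HasDerivAt (flow T) T 0 := by
  have : CompleteSpace E := FiniteDimensional.complete ℂ E
  have h := hasDerivAt_exp_smul_const (𝕂 := ℂ) T ((0 : ℝ) : ℂ)
  rw [Complex.ofReal_zero, zero_smul, NormedSpace.exp_zero, one_mul] at h
  have h2 : HasDerivAt (fun u : ℂ => NormedSpace.exp (u • T)) T ((0 : ℝ) : ℂ) := by simpa using h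
  have h3 := h2.scomp (0 : ℝ) Complex.ofRealCLM.hasDerivAt
  rw [Complex.ofRealCLM_apply, Complex.ofReal_one, one_smul] at h3
  exact h3

theorem hasDerivAt_flow_neg (T : E →L[ℂ] E) : HasDerivAt (fun t => flow T (-t)) (-T) 0 := by
  have h : HasDerivAt (flow T) T (-0) := by rw [neg_zero]; exact hasDerivAt_flow T
  have h2 := h.scomp (0 : ℝ) (hasDerivAt_neg (0 : ℝ))
  rw [neg_one_smul] at h2
  exact h2

theorem hasDerivAt_flow_apply (T : E →L[ℂ] E) {γ : ℝ → E} {γ' : E}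
    (hγ : HasDerivAt γ γ' 0) : HasDerivAt (fun t => flow T t (γ t)) (T (γ 0) + γ') 0 := by
  have h1 : HasDerivAt (fun t => (flow T t).restrictScalars ℝ) (T.restrictScalars ℝ) 0 :=
    (ContinuousLinearMap.restrictScalarsL ℂ E E ℝ ℝ).hasFDerivAt.comp_hasDerivAt _
      (hasDerivAt_flow T)
  have := h1.clm_apply hγ
  simpa [flow_zero] using this

theorem hasDerivAt_flow_neg_apply (T : E →L[ℂ] E) {γ : ℝ → E} {γ' : E}
    (hγ : HasDerivAt γ γ' 0) : HasDerivAt (fun t => flow T (-t) (γ t)) (-T (γ 0) + γ') 0 := by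
  have h1 : HasDerivAt (fun t => (flow T (-t)).restrictScalars ℝ) ((-T).restrictScalars ℝ) 0 :=
    (ContinuousLinearMap.restrictScalarsL ℂ E E ℝ ℝ).hasFDerivAt.comp_hasDerivAt _
      (hasDerivAt_flow_neg T)
  have := h1.clm_apply hγ
  simpa [flow_zero] using this

/-- Subspaces of finite dimension are closed. This turns statements on lines preserved by flows into
infinitesimal ones. -/
theorem mem_of_hasDerivAt (S : Submodule ℂ E) {γ : ℝ → E} {γ' : E} (hγ : HasDerivAt γ γ' 0)
    (h : ∀ᶠ t in 𝓝 0, γ t ∈ S) : γ' ∈ S := by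
  have hc : IsClosed (S : Set E) := S.closed_of_finiteDimensional
  refine hc.mem_of_tendsto (hasDerivAt_iff_tendsto_slope.1 hγ) ?_
  filter_upwards [h.filter_mono nhdsWithin_le_nhds] with t ht
  rw [slope_def_module]
  exact S.smul_of_tower_mem _ (S.sub_mem ht h.self_of_nhds)

theorem flow_apply_eigenvector {T : E →L[ℂ] E} {μ : ℂ} {w : E} (h : T w = μ • w) (t : ℝ) :
    flow T t w = Complex.exp (t * μ) • w := by
  have : CompleteSpace E := FiniteDimensional.complete ℂ E
  have hp : ∀ n : ℕ, (((t : ℂ) • T) ^ n) w = ((t : ℂ) * μ) ^ n • w := by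
    intro n
    induction n with
    | zero => simp
    | succ n ih =>
      rw [pow_succ', mul_apply_eq_comp, ih, map_smul, smul_apply, h, smul_smul,
        smul_smul, pow_succ, mul_assoc]
  have h1 := (NormedSpace.exp_series_hasSum_exp' (𝕂 := ℂ) ((t : ℂ) • T)).mapL
    (ContinuousLinearMap.apply ℂ E w)
  have h2 := (NormedSpace.exp_series_hasSum_exp' (𝕂 := ℂ) ((t : ℂ) * μ)).smul_const w
  rw [← Complex.exp_eq_exp_ℂ] at h2
  refine h1.unique ?_
  convert h2 using 2 with n
  rw [ContinuousLinearMap.apply_apply, smul_apply, hp, smul_eq_mul, mul_smul]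

end Flow

/-! ### Commuting skew-Hermitian maps -/

/-- The linear map `T` is skew-Hermitian. -/
def IsSkew (T : C3 →L[ℂ] C3) : Prop :=
  ∀ x y : C3, (inner ℂ (T x) y : ℂ) = -inner ℂ x (T y)

theorem isSkew_toEuclideanCLM {A : Matrix (Fin 3) (Fin 3) ℂ} (hA : A.conjTranspose = -A) :
    IsSkew (Matrix.toEuclideanCLM (n := Fin 3) (𝕜 := ℂ) A) := by
  intro x y
  have h1 : star (Matrix.toEuclideanCLM (n := Fin 3) (𝕜 := ℂ) A) =
      -Matrix.toEuclideanCLM (n := Fin 3) (𝕜 := ℂ) A := by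
    rw [← map_star, Matrix.star_eq_conjTranspose, hA, map_neg]
  rw [← ContinuousLinearMap.adjoint_inner_right, ← ContinuousLinearMap.star_eq_adjoint, h1,
    neg_apply, inner_neg_right]

theorem IsSkew.isSymmetric {T : C3 →L[ℂ] C3} (hT : IsSkew T) :
    LinearMap.IsSymmetric ((Complex.I • T : C3 →L[ℂ] C3) : C3 →ₗ[ℂ] C3) := by
  intro x y
  have := hT x y
  simp only [ContinuousLinearMap.coe_coe, smul_apply]
  erw [inner_smul_left, inner_smul_right, this]
  simp

theorem IsSkew.eigenvalue_eq {T : C3 →L[ℂ] C3} (hT : IsSkew T) {w : C3} (hw : w ≠ 0) {μ : ℂ}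
    (h : T w = μ • w) : μ = μ.im * Complex.I := by
  have h1 := hT w w
  rw [h, inner_smul_left, inner_smul_right] at h1
  have h2 : (inner ℂ w w : ℂ) ≠ 0 := inner_self_ne_zero.2 hw
  have h3 : (starRingEnd ℂ) μ = -μ := mul_right_cancel₀ h2 (by rw [h1]; ring)
  have h4 := congrArg Complex.re h3
  simp only [Complex.conj_re, Complex.neg_re] at h4
  apply Complex.ext <;> simp
  linarith

theorem exists_joint_eigenbasis {S T : C3 →L[ℂ] C3} (hS : IsSkew S) (hT : IsSkew T)
    (hST : S * T = T * S) :
    ∃ (b : OrthonormalBasis (Fin 3) ℂ C3) (s t : Fin 3 → ℝ),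
      (∀ j, S (b j) = (s j * Complex.I : ℂ) • b j) ∧
      (∀ j, T (b j) = (t j * Complex.I : ℂ) • b j) := by
  classical
  set S' := ((Complex.I • S : C3 →L[ℂ] C3) : C3 →ₗ[ℂ] C3)
  set T' := ((Complex.I • T : C3 →L[ℂ] C3) : C3 →ₗ[ℂ] C3)
  have hcomm : Commute S' T' := by
    ext1 x
    have := congrArg (fun R : C3 →L[ℂ] C3 => R x) hST
    simp only [mul_apply_eq_comp] at this
    simp [S', T', this]
  have hint := LinearMap.IsSymmetric.directSum_isInternal_of_commute hS.isSymmetric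
    hT.isSymmetric hcomm
  have horth := LinearMap.IsSymmetric.orthogonalFamily_eigenspace_inf_eigenspace hS.isSymmetric
    hT.isSymmetric
  -- The family is indexed by all of `ℂ × ℂ`; dropping the zero joint eigenspaces leaves a finite
  -- index type, as the orthonormal basis requires.
  have hint' := DirectSum.isInternal_ne_bot_iff.2 hint
  have hfin := WellFoundedGT.finite_ne_bot_of_iSupIndep hint.submodule_iSupIndep
  have : Fintype {i : ℂ × ℂ //
    Module.End.eigenspace S' i.2 ⊓ Module.End.eigenspace T' i.1 ≠ ⊥} := hfin.fintype
  have horth' := horth.comp (γ := {i : ℂ × ℂ //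
    Module.End.eigenspace S' i.2 ⊓ Module.End.eigenspace T' i.1 ≠ ⊥}) Subtype.val_injective
  have hn : Module.finrank ℂ C3 = 3 := by simp
  set b := hint'.subordinateOrthonormalBasis hn horth'
  have hb : ∀ j, ∃ i : ℂ × ℂ,
      b j ∈ Module.End.eigenspace S' i.2 ⊓ Module.End.eigenspace T' i.1 := fun j =>
    ⟨_, hint'.subordinateOrthonormalBasis_subordinate hn j horth'⟩
  choose i hi using hb
  have hS1 : ∀ j, S (b j) = (-Complex.I * (i j).2) • b j := fun j => by
    have h1 : Complex.I • S (b j) = (i j).2 • b j := Module.End.mem_eigenspace_iff.1 (hi j).1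
    rw [mul_smul, ← h1, smul_smul]
    simp
  have hT1 : ∀ j, T (b j) = (-Complex.I * (i j).1) • b j := fun j => by
    have h1 : Complex.I • T (b j) = (i j).1 • b j := Module.End.mem_eigenspace_iff.1 (hi j).2
    rw [mul_smul, ← h1, smul_smul]
    simp
  have hne : ∀ j, b j ≠ 0 := fun j => b.orthonormal.ne_zero j
  refine ⟨b, fun j => (-Complex.I * (i j).2).im, fun j => (-Complex.I * (i j).1).im,
    fun j => ?_, fun j => ?_⟩
  · rw [← hS.eigenvalue_eq (hne j) (hS1 j)]
    exact hS1 j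
  · rw [← hT.eigenvalue_eq (hne j) (hT1 j)]
    exact hT1 j

/-! ### Homogeneous Lagrangian tori -/

theorem flow_ne_zero (T : C3 →L[ℂ] C3) (t : ℝ) {w : C3} (hw : w ≠ 0) : flow T t w ≠ 0 := by
  intro h
  apply hw
  rw [← flow_neg_flow T t w, h, map_zero]

theorem expAct_mk (A : Matrix (Fin 3) (Fin 3) ℂ) (t : ℝ) {w : C3} (hw : w ≠ 0) :
    expAct A t (Projectivization.mk ℂ w hw) =
      Projectivization.mk ℂ (flow (Matrix.toEuclideanCLM (n := Fin 3) (𝕜 := ℂ) A) t w)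
        (flow_ne_zero _ t hw) := by
  rw [expAct, projAct, Projectivization.map_mk]
  congr 1
  rw [toEuclideanLin_exp, map_smul]
  rfl

theorem IsLift.eq_mk {U : ℝ × ℝ → CP2} {W : Set (ℝ × ℝ)} {f : ℝ × ℝ → C3} (hf : IsLift U W f)
    {p : ℝ × ℝ} (hp : p ∈ W) : ∃ h : f p ≠ 0, U p = Projectivization.mk ℂ (f p) h := by
  obtain ⟨h1, h2⟩ := hf.lifts p hp
  exact ⟨ne_zero_of_mem_unit_sphere ⟨f p, h1⟩, h2.symm⟩

theorem IsLift.differentiableAt {U : ℝ × ℝ → CP2} {W : Set (ℝ × ℝ)} {f : ℝ × ℝ → C3}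
    (hf : IsLift U W f) {p : ℝ × ℝ} (hp : p ∈ W) : DifferentiableAt ℝ f p :=
  (hf.smooth.contDiffAt (hf.isOpen.mem_nhds hp)).differentiableAt (by simp)

theorem mem_span_of_mk_eq {v w : C3} {hv : v ≠ 0} {hw : w ≠ 0}
    (h : Projectivization.mk ℂ v hv = Projectivization.mk ℂ w hw) :
    v ∈ Submodule.span ℂ {w} :=
  Submodule.mem_span_singleton.2 ((Projectivization.mk_eq_mk_iff' ℂ _ _ _ _).1 h)

theorem map_mem_span_singleton (T : C3 →L[ℂ] C3) {v w : C3} (h : v ∈ Submodule.span ℂ {w}) :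
    T v ∈ Submodule.span ℂ {T w} := by
  obtain ⟨a, rfl⟩ := Submodule.mem_span_singleton.1 h
  exact Submodule.mem_span_singleton.2 ⟨a, (map_smul T a w).symm⟩

theorem hor_eq_zero_of_mem_span {z v : C3} (hz : ‖z‖ = 1) (h : v ∈ Submodule.span ℂ {z}) :
    hor z v = 0 := by
  obtain ⟨a, rfl⟩ := Submodule.mem_span_singleton.1 h
  rw [hor_smul, hor_self hz, smul_zero]

/-- The infinitesimal commutator of two flows fixes the lines on which the flows commute. -/
theorem commutator_mem_span {S T : C3 →L[ℂ] C3} {w : C3}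
    (h : ∀ s t, flow S s (flow T t w) ∈ Submodule.span ℂ {flow T t (flow S s w)}) :
    S (T w) - T (S w) ∈ Submodule.span ℂ {w} := by
  -- The group commutator of the flows keeps `w` on its line; it is differentiated in `s` here, and
  -- then in `t`.
  have h1 : ∀ t, -S w + flow T (-t) (S (flow T t w)) ∈ Submodule.span ℂ {w} := by
    intro t
    have hd := hasDerivAt_flow_neg_apply S (hasDerivAt_clm_apply (flow T (-t))
      (hasDerivAt_flow_apply S (hasDerivAt_const (0 : ℝ) (flow T t w))))
    simp only [flow_zero, one_apply_eq_self, add_zero, flow_neg_flow] at hd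
    refine mem_of_hasDerivAt _ hd (Filter.Eventually.of_forall fun s => ?_)
    have := map_mem_span_singleton (flow S (-s)) (map_mem_span_singleton (flow T (-t)) (h s t))
    rwa [flow_neg_flow, flow_neg_flow] at this
  have hd := (hasDerivAt_flow_neg_apply T (hasDerivAt_clm_apply S
      (hasDerivAt_flow_apply T (hasDerivAt_const (0 : ℝ) w)))).const_add (-S w)
  simp only [flow_zero, one_apply_eq_self, add_zero] at hd
  rw [sub_eq_neg_add]
  exact mem_of_hasDerivAt _ hd (Filter.Eventually.of_forall h1)

/-- An operator which fixes the lines along an orbit of a flow. -/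
theorem commutator_mem_span_of_flow {S C : C3 →L[ℂ] C3} {w : C3}
    (h : ∀ s, C (flow S s w) ∈ Submodule.span ℂ {flow S s w}) :
    C (S w) - S (C w) ∈ Submodule.span ℂ {w} := by
  have hd := hasDerivAt_flow_neg_apply S (hasDerivAt_clm_apply C
    (hasDerivAt_flow_apply S (hasDerivAt_const (0 : ℝ) w)))
  simp only [flow_zero, one_apply_eq_self, add_zero] at hd
  rw [sub_eq_neg_add]
  refine mem_of_hasDerivAt _ hd (Filter.Eventually.of_forall fun s => ?_)
  have := map_mem_span_singleton (flow S (-s)) (h s)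
  rwa [flow_neg_flow] at this

/-- Pulled back by the flow, the lift stays on the line of `f p`, so `df(e) - S (f p)` is vertical.
-/
theorem dHor_eq_of_flow {U : ℝ × ℝ → CP2} {W : Set (ℝ × ℝ)} {f : ℝ × ℝ → C3}
    (hf : IsLift U W f) {p e : ℝ × ℝ} (hp : p ∈ W) {S : C3 →L[ℂ] C3}
    (h : ∀ (t : ℝ) (w : C3) (hw : w ≠ 0), U p = Projectivization.mk ℂ w hw →
      U (p + t • e) = Projectivization.mk ℂ (flow S t w) (flow_ne_zero S t hw)) :
    dHor f p e = hor (f p) (S (f p)) := by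
  have hline : HasDerivAt (fun t : ℝ => f (p + t • e)) (fderiv ℝ f p e) 0 := by
    have h1 : HasDerivAt (fun t : ℝ => p + t • e) e 0 := by
      simpa using ((hasDerivAt_id (0 : ℝ)).smul_const e).const_add p
    have h2 : HasFDerivAt f (fderiv ℝ f p) (p + (0 : ℝ) • e) := by
      simpa using (hf.differentiableAt hp).hasFDerivAt
    exact h2.comp_hasDerivAt (0 : ℝ) h1
  have hd := hasDerivAt_flow_neg_apply S hline
  rw [zero_smul, add_zero] at hd
  have hmem : ∀ᶠ t : ℝ in 𝓝 0, p + t • e ∈ W := by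
    have hc : Continuous fun t : ℝ => p + t • e := by fun_prop
    refine hc.continuousAt.eventually_mem (hf.isOpen.mem_nhds ?_)
    simpa using hp
  have hmem2 : -S (f p) + fderiv ℝ f p e ∈ Submodule.span ℂ {f p} := by
    refine mem_of_hasDerivAt _ hd (hmem.mono fun t ht => ?_)
    obtain ⟨h0, h1⟩ := hf.eq_mk hp
    obtain ⟨h2, h3⟩ := hf.eq_mk ht
    have := map_mem_span_singleton (flow S (-t)) (mem_span_of_mk_eq (h3.symm.trans (h t _ h0 h1)))
    rwa [flow_neg_flow] at this
  have h4 := hor_eq_zero_of_mem_span (hf.norm hp) hmem2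
  rw [hor_add, ← neg_one_smul ℂ, hor_smul, neg_one_smul] at h4
  exact (neg_add_eq_zero.1 h4).symm

theorem dHor_add (f : ℝ × ℝ → C3) (p v w : ℝ × ℝ) :
    dHor f p (v + w) = dHor f p v + dHor f p w := by
  rw [dHor, map_add, hor_add]; rfl

theorem dHor_smul (f : ℝ × ℝ → C3) (p v : ℝ × ℝ) (c : ℝ) :
    dHor f p (c • v) = (c : ℂ) • dHor f p v := by
  rw [dHor, map_smul, dHor, ← hor_smul]; rfl

/-! ### The complex frame of a Lagrangian immersion and the commuting generators -/

theorem eq_zero_of_frame {U : ℝ × ℝ → CP2} (hU : IsLagrangianImmersion U) {W : Set (ℝ × ℝ)}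
    {f : ℝ × ℝ → C3} (hf : IsLift U W f) {p : ℝ × ℝ} (hp : p ∈ W) {V : Type*} [AddCommGroup V]
    [Module ℂ V] (L : C3 →ₗ[ℂ] V) (h0 : L (f p) = 0) (h1 : L (dHor f p (1, 0)) = 0)
    (h2 : L (dHor f p (0, 1)) = 0) : L = 0 := by
  have hli : LinearIndependent ℂ ![f p, dHor f p (1, 0), dHor f p (0, 1)] := by
    rw [Fintype.linearIndependent_iff]
    intro x hx
    simp only [Fin.sum_univ_three, Matrix.cons_val_zero, Matrix.cons_val_one,
      Matrix.cons_val_two, Matrix.head_cons, Matrix.tail_cons] at hx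
    have hz := hf.norm hp
    have hx0 : x 0 = 0 := by
      have := congrArg (fun v => (inner ℂ (f p) v : ℂ)) hx
      simp only [inner_add_right, inner_smul_right, dHor, inner_hor hz,
        inner_self_of_norm_one hz, inner_zero_right] at this
      simpa using this
    rw [hx0, zero_smul, zero_add] at hx
    set P := dHor f p ((x 1).re, (x 2).re)
    set Q := dHor f p ((x 1).im, (x 2).im)
    have hdec : ∀ a b : ℝ, dHor f p (a, b) = (a : ℂ) • dHor f p (1, 0) +
        (b : ℂ) • dHor f p (0, 1) := fun a b => by
      rw [← dHor_smul, ← dHor_smul, ← dHor_add]; simp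
    -- A complex relation between the two tangent vectors is `P + iQ = 0` with `P`, `Q` tangent;
    -- then `⟨Q, P⟩ = -i ‖Q‖²`, whose imaginary part vanishes by the Lagrangian condition.
    have hPQ : P + Complex.I • Q = 0 := by
      have key : ∀ (a b c d : ℂ) (X Y : C3), a • X + b • Y + Complex.I • (c • X + d • Y) =
          (a + c * Complex.I) • X + (b + d * Complex.I) • Y := by
        intros; module
      simp only [P, Q]
      rw [hdec (x 1).re, hdec (x 1).im, key, Complex.re_add_im, Complex.re_add_im, hx]
    have hk : (inner ℂ Q P : ℂ).im = 0 := by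
      have := hU.2 W f hf p hp ((x 1).re, (x 2).re) ((x 1).im, (x 2).im)
      rw [kahler_eq] at this
      simpa using this
    have hP : P = (-Complex.I) • Q := by rw [neg_smul]; exact eq_neg_of_add_eq_zero_left hPQ
    have hQ : Q = 0 := by
      rw [hP, inner_smul_right, inner_self_eq_norm_sq_to_K] at hk
      have : ‖Q‖ ^ 2 = 0 := by
        have e : -Complex.I * ((‖Q‖ : ℂ)) ^ 2 = ((-(‖Q‖ ^ 2) : ℝ) : ℂ) * Complex.I := by
          push_cast; ring
        have hk' : (-Complex.I * ((‖Q‖ : ℂ)) ^ 2).im = 0 := hk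
        rw [e, Complex.im_ofReal_mul, Complex.I_im] at hk'
        linarith
      simpa using this
    have hP0 : P = 0 := by rw [hP, hQ, smul_zero]
    have hd0 : dHor f p 0 = 0 := by
      have := dHor_smul f p 0 0
      simpa using this
    have hinj := hU.1.2 W f hf p hp
    have e1 := hinj (hP0.trans hd0.symm)
    have e2 := hinj (hQ.trans hd0.symm)
    rw [Prod.ext_iff] at e1 e2
    intro i
    fin_cases i
    · exact hx0
    · exact Complex.ext e1.1 e2.1
    · exact Complex.ext e1.2 e2.2
  have hspan := hli.span_eq_top_of_card_eq_finrank' (by simp)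
  refine LinearMap.ext_on_range hspan fun i => ?_
  fin_cases i
  · exact h0
  · exact h1
  · exact h2

theorem eq_zero_of_generators {U : ℝ × ℝ → CP2} (hU : IsLagrangianImmersion U)
    {W : Set (ℝ × ℝ)} {f : ℝ × ℝ → C3} (hf : IsLift U W f) {p : ℝ × ℝ} (hp : p ∈ W)
    {S T : C3 →L[ℂ] C3} (hS : dHor f p (1, 0) = hor (f p) (S (f p)))
    (hT : dHor f p (0, 1) = hor (f p) (T (f p))) {V : Type*} [AddCommGroup V] [Module ℂ V]
    (L : C3 →ₗ[ℂ] V) (h0 : L (f p) = 0) (h1 : L (S (f p)) = 0) (h2 : L (T (f p)) = 0) : L = 0 := by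
  refine eq_zero_of_frame hU hf hp L h0 ?_ ?_
  · rw [hS, hor_eq, map_sub, map_smul, h0, h1, smul_zero, sub_zero]
  · rw [hT, hor_eq, map_sub, map_smul, h0, h2, smul_zero, sub_zero]

theorem IsSkew.commutator {S T : C3 →L[ℂ] C3} (hS : IsSkew S) (hT : IsSkew T) :
    IsSkew (S * T - T * S) := by
  intro x y
  simp only [sub_apply, mul_apply_eq_comp, inner_sub_left, inner_sub_right]
  rw [hS (T x) y, hT x (S y), hT (S x) y, hS x (T y)]
  ring

/-- The eigenvalue `ν` is imaginary, so `C - ν` is skew and has values orthogonal to `w`; its value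
at `S w` also lies on the line of `w`. -/
theorem eq_zero_of_skew_commutator {C S : C3 →L[ℂ] C3} (hC : IsSkew C) {w : C3} (hw : ‖w‖ = 1)
    {ν : ℂ} (hν : C w = ν • w) (h : C (S w) - S (C w) ∈ Submodule.span ℂ {w}) :
    C (S w) - ν • S w = 0 := by
  obtain ⟨κ, hκ⟩ := Submodule.mem_span_singleton.1 h
  rw [hν, map_smul] at hκ
  have hw0 : w ≠ 0 := norm_pos_iff.1 (hw ▸ one_pos)
  have him := hC.eigenvalue_eq hw0 hν
  have h1 : (inner ℂ w (C (S w) - ν • S w) : ℂ) = 0 := by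
    have h2 := hC w (S w)
    rw [hν, inner_smul_left] at h2
    have h3 : (starRingEnd ℂ) ν = -ν := by
      rw [him]; simp
    rw [inner_sub_right, inner_smul_right]
    rw [h3] at h2
    linear_combination h2
  rw [← hκ, inner_smul_right, inner_self_of_norm_one hw, mul_one] at h1
  rw [← hκ, h1, zero_smul]

theorem eq_zero_of_commutator_eq_smul {S T : C3 →L[ℂ] C3} {ν : ℂ}
    (h : ∀ x, S (T x) - T (S x) = ν • x) : ν = 0 := by
  have h1 : (S : C3 →ₗ[ℂ] C3) * (T : C3 →ₗ[ℂ] C3) - (T : C3 →ₗ[ℂ] C3) * (S : C3 →ₗ[ℂ] C3) =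
      ν • 1 := LinearMap.ext h
  have h2 := congrArg (LinearMap.trace ℂ C3) h1
  rw [map_sub, LinearMap.trace_mul_comm, sub_self, map_smul, LinearMap.trace_one] at h2
  simpa using h2.symm

theorem exists_rephased_basis (b : OrthonormalBasis (Fin 3) ℂ C3) {e : Fin 3 → ℂ}
    (he : ∀ j, ‖e j‖ = 1) : ∃ b' : OrthonormalBasis (Fin 3) ℂ C3, ∀ j, b' j = e j • b j := by
  have hon : Orthonormal ℂ fun j => e j • b j := by
    refine ⟨fun j => by rw [norm_smul, he, b.orthonormal.1 j, mul_one], fun i j hij => ?_⟩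
    change (inner ℂ (e i • b i) (e j • b j) : ℂ) = 0
    erw [inner_smul_left, inner_smul_right, b.orthonormal.2 hij]
    simp
  have hspan := hon.linearIndependent.span_eq_top_of_card_eq_finrank' (by simp)
  exact ⟨OrthonormalBasis.mk hon hspan.ge, fun j => by rw [OrthonormalBasis.coe_mk]⟩

theorem onPlane_add_smul (p : ℝ × ℝ) (u : Torus → CP2) (t : ℝ) :
    onPlane u (p + t • (1, 0)) =
      u ((p.1 : AddCircle (2 * π)) + (t : AddCircle (2 * π)), (p.2 : AddCircle (2 * π))) ∧
    onPlane u (p + t • (0, 1)) =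
      u ((p.1 : AddCircle (2 * π)), (p.2 : AddCircle (2 * π)) + (t : AddCircle (2 * π))) := by
  constructor <;> simp [onPlane]

theorem commute_of_lagrangian {u : Torus → CP2} (hu : IsLagrangianImmersion (onPlane u))
    {S T : C3 →L[ℂ] C3} (hS : IsSkew S) (hT : IsSkew T)
    (h1 : ∀ (p : ℝ × ℝ) (t : ℝ) (w : C3) (hw : w ≠ 0), onPlane u p = Projectivization.mk ℂ w hw →
      onPlane u (p + t • (1, 0)) = Projectivization.mk ℂ (flow S t w) (flow_ne_zero S t hw))
    (h2 : ∀ (p : ℝ × ℝ) (t : ℝ) (w : C3) (hw : w ≠ 0), onPlane u p = Projectivization.mk ℂ w hw →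
      onPlane u (p + t • (0, 1)) = Projectivization.mk ℂ (flow T t w) (flow_ne_zero T t hw)) :
    S * T = T * S := by
  have hC := hS.commutator hT
  have key : ∀ (p : ℝ × ℝ) (w : C3) (hw : w ≠ 0), onPlane u p = Projectivization.mk ℂ w hw →
      (S * T - T * S) w ∈ Submodule.span ℂ {w} := by
    intro p w hw hp
    refine commutator_mem_span fun s t => ?_
    have e1 := h1 _ s _ _ (h2 _ t _ _ hp)
    have e2 := h2 _ t _ _ (h1 _ s _ _ hp)
    rw [add_right_comm] at e1
    exact mem_span_of_mk_eq (e1.symm.trans e2)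
  obtain ⟨W, f, hp, hf⟩ := hu.1.1 0
  obtain ⟨hw, hmk⟩ := hf.eq_mk hp
  have hnorm := hf.norm hp
  obtain ⟨ν, hν⟩ := Submodule.mem_span_singleton.1 (key 0 _ hw hmk)
  have hCS := eq_zero_of_skew_commutator hC hnorm hν.symm
    (commutator_mem_span_of_flow (S := S) fun s => key _ _ _ (h1 _ s _ _ hmk))
  have hCT := eq_zero_of_skew_commutator hC hnorm hν.symm
    (commutator_mem_span_of_flow (S := T) fun s => key _ _ _ (h2 _ s _ _ hmk))
  have hL := eq_zero_of_generators hu hf hp (dHor_eq_of_flow hf hp (h1 0))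
    (dHor_eq_of_flow hf hp (h2 0))
    (((S * T - T * S : C3 →L[ℂ] C3) : C3 →ₗ[ℂ] C3) - ν • (1 : C3 →ₗ[ℂ] C3))
    (sub_eq_zero.2 hν.symm) hCS hCT
  have hx : ∀ x, S (T x) - T (S x) = ν • x := fun x =>
    sub_eq_zero.1 (congrArg (fun L : C3 →ₗ[ℂ] C3 => L x) hL)
  have hν0 := eq_zero_of_commutator_eq_smul hx
  refine ContinuousLinearMap.ext fun x => ?_
  have := hx x
  rw [hν0, zero_smul, sub_eq_zero] at this
  exact this

/-- Subtracting the weighted means `σ`, `τ` of the frequencies only multiplies the representative by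
a common phase and makes the forms balanced. The differences `α j - α k` are unaffected, which
serves to check injectivity. -/
theorem exists_toricLift_of_lift {U : ℝ × ℝ → CP2} {b : OrthonormalBasis (Fin 3) ℂ C3}
    {r : Fin 3 → ℝ} (hr : ∀ j, 0 < r j) (hsum : ∑ j, r j ^ 2 = 1) (s t : Fin 3 → ℝ)
    (h : ∀ p, ∃ hz, U p = Projectivization.mk ℂ
      (∑ j, (r j * Complex.exp ((s j * p.1 + t j * p.2) * Complex.I) : ℂ) • b j) hz) :
    ∃ α : Fin 3 → ℝ × ℝ →L[ℝ] ℝ, IsLift U Set.univ (toricLift b r α) ∧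
      (∀ j k v, α j v - α k v = (s j - s k) * v.1 + (t j - t k) * v.2) ∧
      ((∀ v, (∀ j, α j v = 0) → v = 0) → IsToricDatum r α) := by
  set σ := ∑ j, r j ^ 2 * s j with hσ
  set τ := ∑ j, r j ^ 2 * t j with hτ
  let α : Fin 3 → ℝ × ℝ →L[ℝ] ℝ := fun j =>
    (s j - σ) • ContinuousLinearMap.fst ℝ ℝ ℝ + (t j - τ) • ContinuousLinearMap.snd ℝ ℝ ℝ
  have hα : ∀ j v, α j v = (s j - σ) * v.1 + (t j - τ) * v.2 := fun j v => by simp [α]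
  refine ⟨α, ⟨isOpen_univ, (contDiff_toricField b r α 1).contDiffOn, fun p _ => ?_⟩,
    fun j k v => by rw [hα, hα]; ring, fun hinj => ⟨hr, hsum, fun v => ?_, hinj⟩⟩
  · refine ⟨by simpa using norm_toricLift_of_sum_sq b α hsum p, ?_⟩
    obtain ⟨hz, hp⟩ := h p
    rw [hp, hopf, Projectivization.mk_eq_mk_iff']
    refine ⟨Complex.exp (-(σ * p.1 + τ * p.2) * Complex.I), ?_⟩
    rw [Finset.smul_sum]
    simp only [toricLift, toricField, Pi.one_apply, one_mul]
    refine Finset.sum_congr rfl fun j _ => ?_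
    rw [smul_smul, mul_left_comm, ← Complex.exp_add, hα]
    congr 3
    push_cast
    ring
  · have : ∀ j, r j ^ 2 * α j v = (r j ^ 2 * s j - r j ^ 2 * σ) * v.1 +
        (r j ^ 2 * t j - r j ^ 2 * τ) * v.2 := fun j => by rw [hα]; ring
    simp only [this, Finset.sum_add_distrib, ← Finset.sum_mul, Finset.sum_sub_distrib, hsum,
      ← hσ, ← hτ]
    ring

theorem injective_of_isImmersion {U : ℝ × ℝ → CP2} (hU : IsImmersion U)
    {b : OrthonormalBasis (Fin 3) ℂ C3} {r : Fin 3 → ℝ} {α : Fin 3 → ℝ × ℝ →L[ℝ] ℝ}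
    (hlift : IsLift U Set.univ (toricLift b r α)) (v : ℝ × ℝ) (hv : ∀ j, α j v = 0) : v = 0 := by
  have hd : ∀ v, (∀ j, α j v = 0) → dHor (toricLift b r α) 0 v = 0 := fun v hv => by
    rw [dHor, fderiv_toricLift]
    simp [hv, toricField, hor_eq]
  exact hU.2 _ _ hlift 0 (Set.mem_univ _) ((hd v hv).trans (hd 0 (by simp)).symm)

theorem exists_toricLift {u : Torus → CP2} (hu : IsLagrangianImmersion (onPlane u))
    (hom : IsHomogeneous u) :
    ∃ (b : OrthonormalBasis (Fin 3) ℂ C3) (r : Fin 3 → ℝ) (α : Fin 3 → ℝ × ℝ →L[ℝ] ℝ),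
      IsToricDatum r α ∧ IsLift (onPlane u) Set.univ (toricLift b r α) := by
  obtain ⟨A, B, hA, hB, hAu, hBu⟩ := hom
  have hS := isSkew_toEuclideanCLM hA
  have hT := isSkew_toEuclideanCLM hB
  set S := Matrix.toEuclideanCLM (n := Fin 3) (𝕜 := ℂ) A
  set T := Matrix.toEuclideanCLM (n := Fin 3) (𝕜 := ℂ) B
  have h1 : ∀ (p : ℝ × ℝ) (t : ℝ) (w : C3) (hw : w ≠ 0),
      onPlane u p = Projectivization.mk ℂ w hw →
      onPlane u (p + t • (1, 0)) = Projectivization.mk ℂ (flow S t w) (flow_ne_zero S t hw) := by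
    intro p t w hw hp
    rw [(onPlane_add_smul p u t).1, hAu, ← expAct_mk A t hw, ← hp]
    rfl
  have h2 : ∀ (p : ℝ × ℝ) (t : ℝ) (w : C3) (hw : w ≠ 0),
      onPlane u p = Projectivization.mk ℂ w hw →
      onPlane u (p + t • (0, 1)) = Projectivization.mk ℂ (flow T t w) (flow_ne_zero T t hw) := by
    intro p t w hw hp
    rw [(onPlane_add_smul p u t).2, hBu, ← expAct_mk B t hw, ← hp]
    rfl
  obtain ⟨b, s, t, hbS, hbT⟩ := exists_joint_eigenbasis hS hT (commute_of_lagrangian hu hS hT h1 h2)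
  obtain ⟨W, f, hp, hf⟩ := hu.1.1 0
  obtain ⟨hw, hmk⟩ := hf.eq_mk hp
  set w := f 0
  set z : Fin 3 → ℂ := fun j => inner ℂ (b j) w
  -- If a coordinate vanished, the form `⟨b j, ·⟩` would kill `w`, `S w` and `T w`, since `b j` is
  -- an eigenvector of both skew maps; it would then be zero.
  have hz : ∀ j, z j ≠ 0 := by
    intro j hj
    have hL : ((innerSL ℂ (b j) : C3 →L[ℂ] ℂ) : C3 →ₗ[ℂ] ℂ) = 0 := by
      have heig : ∀ {R : C3 →L[ℂ] C3} {a : ℝ}, IsSkew R → R (b j) = (a * Complex.I : ℂ) • b j →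
          (inner ℂ (b j) (R w) : ℂ) = 0 := by
        intro R a hR ha
        have := hR (b j) w
        rw [ha, inner_smul_left] at this
        have hj' : (inner ℂ (b j) w : ℂ) = 0 := hj
        rw [hj', mul_zero] at this
        exact neg_eq_zero.1 this.symm
      exact eq_zero_of_generators hu hf hp (dHor_eq_of_flow hf hp (h1 0))
        (dHor_eq_of_flow hf hp (h2 0)) _ hj (heig hS (hbS j)) (heig hT (hbT j))
    have h3 : (inner ℂ (b j) (b j) : ℂ) = 0 := congrArg (fun L : C3 →ₗ[ℂ] ℂ => L (b j)) hL
    rw [inner_self_of_norm_one (b.orthonormal.1 j)] at h3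
    exact one_ne_zero h3
  have hr : ∀ j, 0 < ‖z j‖ := fun j => norm_pos_iff.2 (hz j)
  have hsum : ∑ j, ‖z j‖ ^ 2 = 1 := by
    have := b.sum_sq_norm_inner_right w
    rw [hf.norm hp] at this
    simpa using this
  obtain ⟨b', hb'⟩ := exists_rephased_basis b (e := fun j => z j / ‖z j‖) fun j => by
    rw [norm_div, Complex.norm_real, norm_norm, div_self (hr j).ne']
  have hexp : w = ∑ j, z j • b j := (b.sum_repr' w).symm
  obtain ⟨α, hlift, -, hα⟩ := exists_toricLift_of_lift (b := b') hr hsum s t fun p => by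
    have h3 := h1 _ p.1 _ _ (h2 _ p.2 _ _ hmk)
    have h4 : (0 : ℝ × ℝ) + p.2 • (0, 1) + p.1 • (1, 0) = p := by ext <;> simp
    have h5 : flow S p.1 (flow T p.2 w) =
        ∑ j, (‖z j‖ * Complex.exp ((s j * p.1 + t j * p.2) * Complex.I) : ℂ) • b' j := by
      rw [hexp, map_sum, map_sum]
      refine Finset.sum_congr rfl fun j _ => ?_
      rw [map_smul, flow_apply_eigenvector (hbT j), map_smul, map_smul,
        flow_apply_eigenvector (hbS j), hb', smul_smul, smul_smul, smul_smul]
      have h6 : (‖z j‖ : ℂ) ≠ 0 := Complex.ofReal_ne_zero.2 (hr j).ne'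
      congr 1
      rw [mul_assoc, ← Complex.exp_add]
      field_simp
      congr 2
      ring
    rw [h4] at h3
    have h7 := flow_ne_zero S p.1 (flow_ne_zero T p.2 hw)
    refine ⟨h5 ▸ h7, h3.trans ?_⟩
    congr 1
  exact ⟨b', _, α, hα (injective_of_isImmersion hu.1 hlift), hlift⟩

/-! ### Images of the product tori -/

/-- The image in the projective plane of the torus of points with coordinates of modulus `r_j` in
the basis `b`. -/
def torusImage (b : OrthonormalBasis (Fin 3) ℂ C3) (r : Fin 3 → ℝ) : Set CP2 :=
  {P | ∃ c : Fin 3 → ℂ, (∀ j, ‖c j‖ = r j) ∧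
    ∃ h : ∑ j, c j • b j ≠ 0, P = Projectivization.mk ℂ (∑ j, c j • b j) h}

theorem norm_sq_sum_smul (b : OrthonormalBasis (Fin 3) ℂ C3) (c : Fin 3 → ℂ) :
    ‖∑ j, c j • b j‖ ^ 2 = ∑ j, ‖c j‖ ^ 2 := by
  rw [← b.sum_sq_norm_inner_right]
  refine Finset.sum_congr rfl fun j _ => ?_
  have := b.orthonormal.inner_right_fintype c j
  erw [this]

theorem norm_sum_smul (b : OrthonormalBasis (Fin 3) ℂ C3) {c : Fin 3 → ℂ} {r : Fin 3 → ℝ}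
    (hr : ∑ j, r j ^ 2 = 1) (hc : ∀ j, ‖c j‖ = r j) : ‖∑ j, c j • b j‖ = 1 := by
  have h := norm_sq_sum_smul b c
  simp only [hc, hr] at h
  nlinarith [norm_nonneg (∑ j, c j • b j)]

theorem sum_smul_ne_zero (b : OrthonormalBasis (Fin 3) ℂ C3) {c : Fin 3 → ℂ} {r : Fin 3 → ℝ}
    (hr : ∑ j, r j ^ 2 = 1) (hc : ∀ j, ‖c j‖ = r j) : ∑ j, c j • b j ≠ 0 :=
  norm_pos_iff.1 ((norm_sum_smul b hr hc).symm ▸ one_pos)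

theorem sum_basisFun (c : C3) : ∑ j, c j • EuclideanSpace.basisFun (Fin 3) ℂ j = c := by
  ext i
  simp [Fin.sum_univ_three]
  fin_cases i <;> simp

theorem hopf_image_productTorus {r : Fin 3 → ℝ} (hr : ∑ j, r j ^ 2 = 1) :
    hopf '' productTorus r = torusImage (EuclideanSpace.basisFun (Fin 3) ℂ) r := by
  ext P
  constructor
  · rintro ⟨z, hz, rfl⟩
    have h := sum_smul_ne_zero (EuclideanSpace.basisFun (Fin 3) ℂ) hr hz
    refine ⟨fun j => (z : C3) j, hz, h, ?_⟩
    rw [hopf, Projectivization.mk_eq_mk_iff']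
    exact ⟨1, by rw [one_smul, sum_basisFun]⟩
  · rintro ⟨c, hc, h, rfl⟩
    have hn := norm_sum_smul (EuclideanSpace.basisFun (Fin 3) ℂ) hr hc
    refine ⟨⟨_, mem_sphere_zero_iff_norm.2 hn⟩, fun j => ?_, rfl⟩
    rw [← hc j]
    congr 1
    have := congrArg (fun v : C3 => v j) (sum_basisFun (WithLp.toLp 2 c))
    simpa using this

theorem unitaryAct_image_productTorus {g : Matrix.unitaryGroup (Fin 3) ℂ}
    {b : OrthonormalBasis (Fin 3) ℂ C3}
    (hg : ∀ j, Matrix.toEuclideanLin (g : Matrix (Fin 3) (Fin 3) ℂ)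
      (EuclideanSpace.basisFun (Fin 3) ℂ j) = b j) {r : Fin 3 → ℝ} (hr : ∑ j, r j ^ 2 = 1) :
    unitaryAct g '' (hopf '' productTorus r) = torusImage b r := by
  have hsum : ∀ c : Fin 3 → ℂ, Matrix.toEuclideanLin (g : Matrix (Fin 3) (Fin 3) ℂ)
      (∑ j, c j • EuclideanSpace.basisFun (Fin 3) ℂ j) = ∑ j, c j • b j := fun c => by
    rw [map_sum]
    exact Finset.sum_congr rfl fun j _ => by rw [map_smul, hg]
  rw [hopf_image_productTorus hr]
  ext P
  constructor
  · rintro ⟨_, ⟨c, hc, h, rfl⟩, rfl⟩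
    refine ⟨c, hc, sum_smul_ne_zero b hr hc, ?_⟩
    rw [unitaryAct, projAct, Projectivization.map_mk]
    congr 1
    exact hsum c
  · rintro ⟨c, hc, h, rfl⟩
    refine ⟨_, ⟨c, hc, sum_smul_ne_zero _ hr hc, rfl⟩, ?_⟩
    rw [unitaryAct, projAct, Projectivization.map_mk]
    congr 1
    exact hsum c

theorem exists_basis_of_unitary (g : Matrix.unitaryGroup (Fin 3) ℂ) :
    ∃ b : OrthonormalBasis (Fin 3) ℂ C3, ∀ j,
      Matrix.toEuclideanLin (g : Matrix (Fin 3) (Fin 3) ℂ)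
        (EuclideanSpace.basisFun (Fin 3) ℂ j) = b j := by
  set T := Matrix.toEuclideanCLM (n := Fin 3) (𝕜 := ℂ) (g : Matrix (Fin 3) (Fin 3) ℂ) with hT
  have hstar : star T * T = 1 := by
    rw [hT, ← map_star, ← map_mul, Unitary.coe_star_mul_self, map_one]
  have hinner : ∀ x y : C3, (inner ℂ (T x) (T y) : ℂ) = inner ℂ x y := fun x y => by
    have h1 : (star T) (T y) = y := congrArg (fun R : C3 →L[ℂ] C3 => R y) hstar
    have h2 := ContinuousLinearMap.adjoint_inner_right T x (T y)
    rw [← ContinuousLinearMap.star_eq_adjoint, h1] at h2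
    exact h2.symm
  have hon : Orthonormal ℂ fun j => T (EuclideanSpace.basisFun (Fin 3) ℂ j) := by
    rw [orthonormal_iff_ite]
    intro i j
    exact (hinner _ _).trans
      (orthonormal_iff_ite.1 (EuclideanSpace.basisFun (Fin 3) ℂ).orthonormal i j)
  have hspan := hon.linearIndependent.span_eq_top_of_card_eq_finrank' (by simp)
  refine ⟨OrthonormalBasis.mk hon hspan.ge, fun j => ?_⟩
  rw [OrthonormalBasis.coe_mk]
  rfl

theorem exists_unitary_of_basis (b : OrthonormalBasis (Fin 3) ℂ C3) :
    ∃ g : Matrix.unitaryGroup (Fin 3) ℂ, ∀ j,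
      Matrix.toEuclideanLin (g : Matrix (Fin 3) (Fin 3) ℂ)
        (EuclideanSpace.basisFun (Fin 3) ℂ j) = b j := by
  let M : Matrix (Fin 3) (Fin 3) ℂ := Matrix.of fun i j => b j i
  have hM : M ∈ Matrix.unitaryGroup (Fin 3) ℂ := by
    rw [Matrix.mem_unitaryGroup_iff']
    ext i j
    have h := orthonormal_iff_ite.1 b.orthonormal i j
    rw [PiLp.inner_apply] at h
    rw [Matrix.one_apply, ← h, Matrix.mul_apply]
    refine Finset.sum_congr rfl fun k _ => ?_
    simp [M, mul_comm]
  refine ⟨⟨M, hM⟩, fun j => ?_⟩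
  ext i
  simp [M]

theorem range_eq_torusImage {b : OrthonormalBasis (Fin 3) ℂ C3} {r : Fin 3 → ℝ}
    {α : Fin 3 → ℝ × ℝ →L[ℝ] ℝ} (h : IsToricDatum r α) {u : Torus → CP2}
    (hU : IsLift (onPlane u) Set.univ (toricLift b r α)) : Set.range u = torusImage b r := by
  ext P
  constructor
  · rintro ⟨⟨x, y⟩, rfl⟩
    obtain ⟨x, rfl⟩ := QuotientAddGroup.mk_surjective x
    obtain ⟨y, rfl⟩ := QuotientAddGroup.mk_surjective y
    obtain ⟨h0, h1⟩ := hU.eq_mk (Set.mem_univ (x, y))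
    have h2 : toricLift b r α (x, y) =
        ∑ j, (r j * Complex.exp (α j (x, y) * Complex.I) : ℂ) • b j := by
      simp [toricLift, toricField]
    refine ⟨fun j => r j * Complex.exp (α j (x, y) * Complex.I), fun j => ?_, h2 ▸ h0, ?_⟩
    · rw [norm_mul, Complex.norm_exp_ofReal_mul_I, mul_one, Complex.norm_real, Real.norm_eq_abs,
        abs_of_pos (h.pos j)]
    · refine Eq.trans h1 ?_
      congr 1
  · rintro ⟨c, hc, h0, rfl⟩
    -- Removing the common phase `σ` does not change the projective point and makes the arguments a
    -- balanced velocity, which is attained.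
    set σ := ∑ j, r j ^ 2 * (c j).arg with hσ
    obtain ⟨v, hv⟩ := h.exists_velocity (θ := fun j => (c j).arg - σ) (by
      simp only [mul_sub, Finset.sum_sub_distrib, ← Finset.sum_mul, h.sum_sq, one_mul, ← hσ,
        sub_self])
    obtain ⟨h1, h2⟩ := hU.eq_mk (Set.mem_univ v)
    refine ⟨((v.1 : AddCircle (2 * π)), (v.2 : AddCircle (2 * π))), h2.trans ?_⟩
    rw [Projectivization.mk_eq_mk_iff']
    refine ⟨Complex.exp (-σ * Complex.I), ?_⟩
    rw [Finset.smul_sum, toricLift, toricField]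
    refine Finset.sum_congr rfl fun j _ => ?_
    rw [hv, smul_smul, Pi.one_apply, one_mul]
    congr 1
    have e := Complex.norm_mul_exp_arg_mul_I (c j)
    rw [hc] at e
    conv_lhs => rw [← e]
    rw [mul_left_comm, ← Complex.exp_add]
    congr 2
    push_cast
    ring

/-! ### Invariance of the radii -/

/-- The two equalities say that the real and imaginary parts of `R` times the conjugate of `X`
vanish. -/
theorem eq_zero_of_norm_add_eq_norm_sub {R X : ℂ} (hX : X ≠ 0) (h1 : ‖R + X‖ = ‖R - X‖)
    (h2 : ‖R + Complex.I * X‖ = ‖R - Complex.I * X‖) : R = 0 := by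
  have e1 : Complex.normSq (R + X) = Complex.normSq (R - X) := by
    rw [Complex.normSq_eq_norm_sq, Complex.normSq_eq_norm_sq, h1]
  have e2 : Complex.normSq (R + Complex.I * X) = Complex.normSq (R - Complex.I * X) := by
    rw [Complex.normSq_eq_norm_sq, Complex.normSq_eq_norm_sq, h2]
  simp only [Complex.normSq_apply, Complex.add_re, Complex.add_im, Complex.sub_re, Complex.sub_im,
    Complex.mul_re, Complex.mul_im, Complex.I_re, Complex.I_im] at e1 e2
  have : R * (starRingEnd ℂ) X = 0 := by
    apply Complex.ext
    · simp; linarith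
    · simp; linarith
  simpa [hX] using this

/-- Fix `k` with `m k ≠ 0`. Rotating `c k` through `±1`, `±i` shows that the sum of the other terms
is zero, for all choices of their phases; changing the sign of a single `c l` then gives `m l = 0`.
-/
theorem exists_eq_mul_norm {m : Fin 3 → ℂ} {r : Fin 3 → ℝ} (hr : ∀ j, 0 < r j) {ρ : ℝ}
    (hρ : 0 < ρ) (h : ∀ c : Fin 3 → ℂ, (∀ j, ‖c j‖ = r j) → ‖∑ j, c j * m j‖ = ρ) :
    ∃ k, ρ = r k * ‖m k‖ ∧ ∀ l, l ≠ k → m l = 0 := by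
  have hm : ∃ k, m k ≠ 0 := by
    by_contra! hm
    have := h (fun j => r j) fun j => by simp [abs_of_pos (hr j)]
    simp [hm] at this
    exact hρ.ne this
  obtain ⟨k, hk⟩ := hm
  let F : (Fin 3 → ℂ) → ℂ := fun c => ∑ j, c j * m j
  have hadd : ∀ c d, F (c + d) = F c + F d := fun c d => by
    simp [F, add_mul, Finset.sum_add_distrib]
  have hsingle : ∀ l a, F (Pi.single l a) = a * m l := fun l a => by
    simp only [F]
    rw [Finset.sum_eq_single l (by intro j _ hj; simp [hj]) (by simp), Pi.single_eq_same]
  have hnorm : ∀ c : Fin 3 → ℂ, (∀ j, ‖c j‖ = r j) → ∀ ε : ℂ, ‖ε‖ = 1 →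
      ‖F (Function.update c k 0) + ε * (r k * m k)‖ = ρ := by
    intro c hc ε hε
    rw [← mul_assoc, ← hsingle, ← hadd]
    refine h _ fun j => ?_
    by_cases hj : j = k
    · subst hj
      simp [hε, abs_of_pos (hr j)]
    · simp [hj, hc]
  have hX : (r k * m k : ℂ) ≠ 0 := mul_ne_zero (Complex.ofReal_ne_zero.2 (hr k).ne') hk
  have hF : ∀ c : Fin 3 → ℂ, (∀ j, ‖c j‖ = r j) → F (Function.update c k 0) = 0 := by
    intro c hc
    refine eq_zero_of_norm_add_eq_norm_sub hX ?_ ?_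
    · have e1 := hnorm c hc 1 (by simp)
      have e2 := hnorm c hc (-1) (by simp)
      rw [one_mul] at e1
      rw [neg_one_mul, ← sub_eq_add_neg] at e2
      exact e1.trans e2.symm
    · have e1 := hnorm c hc Complex.I (by simp)
      have e2 := hnorm c hc (-Complex.I) (by simp)
      rw [neg_mul, ← sub_eq_add_neg] at e2
      exact e1.trans e2.symm
  have hr' : ∀ j, ‖(r j : ℂ)‖ = r j := fun j => by simp [abs_of_pos (hr j)]
  refine ⟨k, ?_, fun l hl => ?_⟩
  · have e := hnorm (fun j => r j) hr' 1 (by simp)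
    rw [hF _ hr', zero_add, one_mul, norm_mul, hr'] at e
    exact e.symm
  · have e1 := hF (fun j => r j) hr'
    have e2 := hF (Function.update (fun j => (r j : ℂ)) l (-r l)) fun j => by
      by_cases hj : j = l
      · subst hj; simp [abs_of_pos (hr j)]
      · simp [hj, abs_of_pos (hr j)]
    have e3 : Function.update (fun j => (r j : ℂ)) k 0 =
        Function.update (Function.update (fun j => (r j : ℂ)) l (-r l)) k 0 +
          Pi.single l ((2 * r l : ℝ) : ℂ) := by
      ext j
      by_cases hjk : j = k
      · subst hjk; simp [hl.symm]
      · by_cases hjl : j = l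
        · subst hjl; simp [hjk]; ring
        · simp [hjk, hjl]
    rw [e3, hadd, e2, zero_add, hsingle] at e1
    have : ((2 * r l : ℝ) : ℂ) ≠ 0 := Complex.ofReal_ne_zero.2 (by linarith [hr l])
    exact (mul_eq_zero.1 e1).resolve_left this

/-- The `j`-th coordinate in the basis `b'` has constant modulus on the torus of `b`, so `b' j` is
orthogonal to all `b l` but one, `b k`, and is a phase times it. -/
theorem exists_radius_eq {b b' : OrthonormalBasis (Fin 3) ℂ C3} {r r' : Fin 3 → ℝ}
    (hr : ∀ j, 0 < r j) (hr' : ∀ j, 0 < r' j) (hs : ∑ j, r j ^ 2 = 1) (hs' : ∑ j, r' j ^ 2 = 1)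
    (h : torusImage b r ⊆ torusImage b' r') (j : Fin 3) : ∃ k, r' j = r k := by
  obtain ⟨k, hk, hk'⟩ := exists_eq_mul_norm (m := fun k => inner ℂ (b' j) (b k)) hr (hr' j)
    fun c hc => by
      obtain ⟨c', hc', h0, he⟩ := h ⟨c, hc, sum_smul_ne_zero b hs hc, rfl⟩
      obtain ⟨a, ha⟩ := (Projectivization.mk_eq_mk_iff' ℂ _ _ _ _).1 he
      have ha1 : ‖a‖ = 1 := by
        have := congrArg norm ha
        rwa [norm_smul, norm_sum_smul b hs hc, norm_sum_smul b' hs' hc', mul_one] at this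
      have h1 : (inner ℂ (b' j) (∑ k, c k • b k) : ℂ) = ∑ k, c k * inner ℂ (b' j) (b k) := by
        rw [inner_sum]
        exact Finset.sum_congr rfl fun k _ => inner_smul_right _ _ _
      have h2 : (inner ℂ (b' j) (∑ k, c' k • b' k) : ℂ) = c' j :=
        b'.orthonormal.inner_right_fintype c' j
      rw [← h1, ← ha, inner_smul_right, h2, norm_mul, ha1, one_mul, hc']
  refine ⟨k, ?_⟩
  have h3 : ∑ l, ‖(inner ℂ (b' j) (b l) : ℂ)‖ ^ 2 = 1 := by
    have := b.sum_sq_norm_inner_left (b' j)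
    rw [b'.orthonormal.1 j, one_pow] at this
    exact this
  rw [Finset.sum_eq_single k (fun l _ hl => by rw [hk' l hl]; simp) (by simp)] at h3
  have h4 : ‖(inner ℂ (b' j) (b k) : ℂ)‖ = 1 := by
    nlinarith [norm_nonneg (inner ℂ (b' j) (b k) : ℂ)]
  rw [hk, h4, mul_one]

theorem radii_eq_const_iff {b b' : OrthonormalBasis (Fin 3) ℂ C3} {r r' : Fin 3 → ℝ}
    (hr : ∀ j, 0 < r j) (hr' : ∀ j, 0 < r' j) (hs : ∑ j, r j ^ 2 = 1) (hs' : ∑ j, r' j ^ 2 = 1)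
    (h : torusImage b r = torusImage b' r') (a : ℝ) : (∀ j, r j = a) ↔ ∀ j, r' j = a := by
  constructor
  · intro ha j
    obtain ⟨k, hk⟩ := exists_radius_eq hr hr' hs hs' h.le j
    rw [hk, ha]
  · intro ha j
    obtain ⟨k, hk⟩ := exists_radius_eq hr' hr hs' hs h.ge j
    rw [hk, ha]

/-! ### The product tori -/

/-- A point of the product torus. -/
def productPoint (r : Fin 3 → ℝ) (x : Torus) : C3 :=
  WithLp.toLp 2 ![(r 0 * (x.1.toCircle : ℂ) : ℂ), r 1 * (x.2.toCircle : ℂ), r 2]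

theorem productPoint_ne_zero {r : Fin 3 → ℝ} (hr : ∀ j, 0 < r j) (x : Torus) :
    productPoint r x ≠ 0 := by
  intro h
  have := congrArg (fun v : C3 => v 2) h
  simp [productPoint] at this
  exact (hr 2).ne' this

/-- The parametrization of the image of the product torus by the torus. -/
def productMap {r : Fin 3 → ℝ} (hr : ∀ j, 0 < r j) (x : Torus) : CP2 :=
  Projectivization.mk ℂ (productPoint r x) (productPoint_ne_zero hr x)

/-- The third coordinate is the fixed number `r 2 ≠ 0`, so the scalar relating two representatives
is `1`. -/
theorem injective_productMap {r : Fin 3 → ℝ} (hr : ∀ j, 0 < r j) :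
    Function.Injective (productMap hr) := by
  intro x y hxy
  obtain ⟨a, ha⟩ := (Projectivization.mk_eq_mk_iff' ℂ _ _ _ _).1 hxy
  have h : ∀ j, a * productPoint r y j = productPoint r x j := fun j =>
    congrArg (fun v : C3 => v j) ha
  have hne : ∀ j, (r j : ℂ) ≠ 0 := fun j => Complex.ofReal_ne_zero.2 (hr j).ne'
  have h2 := h 2
  simp only [productPoint, Matrix.cons_val] at h2
  have ha1 : a = 1 := mul_right_cancel₀ (hne 2) (h2.trans (one_mul _).symm)
  have h0 := h 0
  have h1 := h 1
  simp only [productPoint, Matrix.cons_val, ha1, one_mul] at h0 h1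
  have hπ : (2 * π : ℝ) ≠ 0 := by positivity
  refine Prod.ext (AddCircle.injective_toCircle hπ ?_) (AddCircle.injective_toCircle hπ ?_)
  · exact (Circle.ext (mul_left_cancel₀ (hne 0) h0)).symm
  · exact (Circle.ext (mul_left_cancel₀ (hne 1) h1)).symm

theorem toCircle_coe_two_pi (x : ℝ) :
    ((AddCircle.toCircle (x : AddCircle (2 * π)) : Circle) : ℂ) = Complex.exp (x * Complex.I) := by
  have hπ : (2 * π : ℝ) ≠ 0 := by positivity
  rw [AddCircle.toCircle_apply_mk, div_self hπ, one_mul, Circle.coe_exp]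

theorem flow_diagonal (d : Fin 3 → ℂ) (t : ℝ) (v : C3) :
    flow (Matrix.toEuclideanCLM (n := Fin 3) (𝕜 := ℂ) (Matrix.diagonal d)) t v =
      WithLp.toLp 2 fun j => Complex.exp (t * d j) * v j := by
  have heig : ∀ j, Matrix.toEuclideanCLM (n := Fin 3) (𝕜 := ℂ) (Matrix.diagonal d)
      (EuclideanSpace.basisFun (Fin 3) ℂ j) = d j • EuclideanSpace.basisFun (Fin 3) ℂ j := by
    intro j
    ext i
    by_cases hij : i = j
    · subst hij
      simp
    · simp [hij]
  conv_lhs => rw [← sum_basisFun v]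
  rw [map_sum]
  refine Eq.trans ?_ (sum_basisFun _)
  refine Finset.sum_congr rfl fun j _ => ?_
  rw [map_smul, flow_apply_eigenvector (heig j), smul_smul, mul_comm]

theorem isHomogeneous_productMap {r : Fin 3 → ℝ} (hr : ∀ j, 0 < r j) :
    IsHomogeneous (productMap hr) := by
  refine ⟨Matrix.diagonal ![Complex.I, 0, 0], Matrix.diagonal ![0, Complex.I, 0], ?_, ?_, ?_, ?_⟩
  · ext i j
    fin_cases i <;> fin_cases j <;> simp
  · ext i j
    fin_cases i <;> fin_cases j <;> simp
  · intro x y t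
    rw [productMap, productMap, expAct_mk]
    congr 1
    rw [flow_diagonal]
    ext j
    fin_cases j <;> simp [productPoint, AddCircle.toCircle_add, toCircle_coe_two_pi]
    ring
  · intro x y t
    rw [productMap, productMap, expAct_mk]
    congr 1
    rw [flow_diagonal]
    ext j
    fin_cases j <;> simp [productPoint, AddCircle.toCircle_add, toCircle_coe_two_pi]
    ring

theorem exists_toricLift_productMap {r : Fin 3 → ℝ} (hr : ∀ j, 0 < r j)
    (hs : ∑ j, r j ^ 2 = 1) : ∃ α, IsToricDatum r α ∧ IsLift (onPlane (productMap hr)) Set.univ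
      (toricLift (EuclideanSpace.basisFun (Fin 3) ℂ) r α) := by
  obtain ⟨α, hlift, hdiff, hα⟩ := exists_toricLift_of_lift (U := onPlane (productMap hr))
    (b := EuclideanSpace.basisFun (Fin 3) ℂ) hr hs ![1, 0, 0] ![0, 1, 0] fun p => by
      have e : productPoint r (p.1, p.2) = ∑ j, (r j * Complex.exp
          (((![1, 0, 0] : Fin 3 → ℝ) j * p.1 + (![0, 1, 0] : Fin 3 → ℝ) j * p.2) * Complex.I) :
            ℂ) • EuclideanSpace.basisFun (Fin 3) ℂ j := by
        refine (sum_basisFun _).symm.trans (Finset.sum_congr rfl fun j _ => ?_)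
        congr 1
        fin_cases j <;> simp [productPoint, toCircle_coe_two_pi]
      have h0 := productPoint_ne_zero hr (p.1, p.2)
      refine ⟨e ▸ h0, ?_⟩
      rw [onPlane, productMap]
      congr 1
  refine ⟨α, hα fun v hv => ?_, hlift⟩
  -- The third frequency is zero, so these two differences are the coordinates of `v`.
  have h0 := hdiff 0 2 v
  have h1 := hdiff 1 2 v
  simp [hv] at h0 h1
  exact Prod.ext h0.symm h1.symm

end

end HSLTorus

/-! ### Assembly of the theorem -/

theorem mainTheorem4 :
    -- classification, and characterization of the special Lagrangian (minimal) tori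
    (∀ u : HSLTorus.Torus → HSLTorus.CP2, HSLTorus.IsHomogeneousHSLTorus u →
      (∃ (g : Matrix.unitaryGroup (Fin 3) ℂ) (r : Fin 3 → ℝ),
        (∀ i, 0 < r i) ∧ ∑ i, r i ^ 2 = 1 ∧
          Set.range u = HSLTorus.unitaryAct g '' (HSLTorus.hopf '' HSLTorus.productTorus r)) ∧
      (∀ (g : Matrix.unitaryGroup (Fin 3) ℂ) (r : Fin 3 → ℝ),
        (∀ i, 0 < r i) → ∑ i, r i ^ 2 = 1 →
          Set.range u = HSLTorus.unitaryAct g '' (HSLTorus.hopf '' HSLTorus.productTorus r) →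
            (HSLTorus.IsSpecialLagrangian u ↔ ∀ i, r i = 1 / √3) ∧
            (HSLTorus.IsMinimal u ↔ ∀ i, r i = 1 / √3))) ∧
    -- all the product tori do occur, as embedded tori
    (∀ r : Fin 3 → ℝ, (∀ i, 0 < r i) → ∑ i, r i ^ 2 = 1 →
      ∃ u : HSLTorus.Torus → HSLTorus.CP2, HSLTorus.IsHomogeneousHSLTorus u ∧
        Function.Injective u ∧ Set.range u = HSLTorus.hopf '' HSLTorus.productTorus r) := by
  refine ⟨fun u hu => ?_, fun r hr hs => ?_⟩
  · obtain ⟨b, r₀, α, h, hU⟩ := HSLTorus.exists_toricLift hu.lagrangian hu.homogeneous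
    have hrange := HSLTorus.range_eq_torusImage h hU
    constructor
    · obtain ⟨g, hg⟩ := HSLTorus.exists_unitary_of_basis b
      exact ⟨g, r₀, h.pos, h.sum_sq,
        hrange.trans (HSLTorus.unitaryAct_image_productTorus hg h.sum_sq).symm⟩
    · intro g r hr hs hur
      obtain ⟨b', hb'⟩ := HSLTorus.exists_basis_of_unitary g
      rw [HSLTorus.unitaryAct_image_productTorus hb' hs] at hur
      -- The given `r` may differ from the radii `r₀` of the toric lift, for instance by a
      -- permutation; being constant is a property of the common image.
      have hiff := HSLTorus.radii_eq_const_iff h.pos hr h.sum_sq hs (hrange.symm.trans hur) (1 / √3)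
      exact ⟨(h.isSpecialLagrangian_iff hU).trans hiff, (h.isMinimal_iff hU).trans hiff⟩
  · obtain ⟨α, h, hU⟩ := HSLTorus.exists_toricLift_productMap hr hs
    refine ⟨HSLTorus.productMap hr, ⟨h.isLagrangianImmersion hU, h.isHamiltonianStationary hU,
      HSLTorus.isHomogeneous_productMap hr⟩, HSLTorus.injective_productMap hr, ?_⟩
    rw [HSLTorus.range_eq_torusImage h hU, HSLTorus.hopf_image_productTorus hs]
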